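/- Let $\mathcal D$ be the standard dyadic grid on $\mathbb R$, that is, the intervals $I=[k2^{-n},(k+1)2^{-n})$ with $n,k\in\mathbb Z$, and let $I_-$, $I_+$ be the left and right halves of $I$. Put $$h^0_I=h_I=|I|^{-1/2}\,(1_{I_-}-1_{I_+}),\qquad h^1_I=|I|^{-1}1_I ,$$ and write $\langle f,g\rangle=\int_{\mathbb R} fg\,dx$, and $\|\cdot\|$ for the norm of the real Hilbert space $L^2(\mathbb R)$ (Lebesgue measure). For a sequence $a=(a_I)_{I\in\mathcal D}$ of real numbers and $\alpha,\beta\in\{0,1\}$ let $$P^{(\alpha,\beta)}_a f=\sum_{I\in\mathcal D}a_I\,\langle f,h^\beta_I\rangle\,h^\alpha_I ,\qquad f\in L^2(\mathbb R),$$ whenever the series converges unconditionally in $L^2(\mathbb R)$. For a function $b$ let $\widehat b=(\langle b,h_I\rangle)_{I\in\mathcal D}$ be its sequence of Haar coefficients. The dyadic Haar shift is the operator on $L^2(\mathbb R)$ given by $Sf=\sum_{I\in\mathcal D}\langle f,h_I\rangle h_{I_-}$, so that $Sh_I=h_{I_-}$. Let $\omega\ge 0$ be a locally integrable function on $\mathbb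 R$ with $\omega>0$ almost everywhere and $$[\omega]_{A_2}=\sup_{I\in\mathcal D}\Big(\frac1{|I|}\int_I\omega\,dx\Big)\Big(\frac1{|I|}\int_I\omega^{-1}\,dx\Big)<\infty .$$ Let $\mathcal E_\omega$ be the set of all $\varphi\in L^2(\mathbb R)$ for which the series for $P^{(1,0)}_{\widehat{\omega^{-1/2}}}\varphi$ converges unconditionally in $L^2(\mathbb R)$. There is an absolute constant $C>0$ such that for every such $\omega$ the following hold. 1. $\mathcal E_\omega$ contains all finite linear combinations of the Haar functions $h_I$, and is dense in $L^2(\mathbb R)$. 2. For every $\varphi\in\mathcal E_\omega$ the series defining $P^{(0,1)}_{\widehat{\omega^{1/2}}}\,S\,P^{(1,0)}_{\widehat{\omega^{-1/2}}}\varphi$ converges unconditionally in $L^2(\mathbb R)$, and the operator $P^{(0,1)}_{\widehat{\omega^{1/2}}}\,S\,P^{(1,0)}_{\widehat{\omega^{-1/2}}}$ extends from $\mathcal E_\omega$ to a bounded linear operator on $L^2(\mathbb R)$ with $$\Big\|P^{(0,1)}_{\widehat{\omega^{1/2}}}\,S\,P^{(1,0)}_{\widehat{\omega^{-1/2}}}\Big\|_{L^2(\mathbb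 R)\to L^2(\mathbb R)}\le C\,[\omega]_{A_2}.$$ 3. For every $\varphi\in\mathcal E_\omega$, $$\Big\|\omega^{1/2}\,S\,P^{(1,0)}_{\widehat{\omega^{-1/2}}}\varphi\Big\|\le C\,[\omega]_{A_2}\,\|\varphi\| .$$ -/

import Mathlib

open MeasureTheory
open scoped ENNReal

noncomputable section

/-- The real Hilbert space `L²(ℝ)` (Lebesgue measure). -/
abbrev L2R : Type := Lp ℝ 2 (volume : Measure ℝ)

/-- The standard dyadic grid: the pair `(n, k)` stands for `[k 2⁻ⁿ, (k + 1) 2⁻ⁿ)`. -/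
@[ext]
structure DyadicInterval where
  n : ℤ
  k : ℤ

namespace DyadicInterval

/-- The length `|I| = 2⁻ⁿ`. -/
def len (I : DyadicInterval) : ℝ := (2 : ℝ) ^ (-I.n)

/-- The underlying half-open interval. -/
def toSet (I : DyadicInterval) : Set ℝ := Set.Ico (I.k * I.len) ((I.k + 1) * I.len)

/-- The left child `I₋`. -/
def left (I : DyadicInterval) : DyadicInterval := ⟨I.n + 1, 2 * I.k⟩

/-- The right child `I₊`. -/
def right (I : DyadicInterval) : DyadicInterval := ⟨I.n + 1, 2 * I.k + 1⟩

/-- The function `h^α_I`: for `α = 0` the Haar function `|I|^{-1/2} (1_{I₋} - 1_{I₊})`,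
for `α = 1` the averaging function `|I|⁻¹ 1_I`. -/
def h (α : Fin 2) (I : DyadicInterval) : ℝ → ℝ :=
  match α with
  | 0 => fun x =>
      (√I.len)⁻¹ * (I.left.toSet.indicator (fun _ => 1) x - I.right.toSet.indicator (fun _ => 1) x)
  | 1 => fun x => I.len⁻¹ * I.toSet.indicator (fun _ => 1) x

theorem memLp_indicator (I : DyadicInterval) :
    MemLp (I.toSet.indicator (fun _ => (1 : ℝ))) 2 (volume : Measure ℝ) := by
  refine memLp_indicator_const 2 measurableSet_Ico 1 (Or.inr ?_)
  simp

theorem memLp_h (α : Fin 2) (I : DyadicInterval) : MemLp (h α I) 2 (volume : Measure ℝ) := by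
  match α with
  | 0 => exact (I.left.memLp_indicator.sub I.right.memLp_indicator).const_mul _
  | 1 => exact I.memLp_indicator.const_mul _

/-- The function `h^α_I` as an element of `L²(ℝ)`. -/
def hL2 (α : Fin 2) (I : DyadicInterval) : L2R := (memLp_h α I).toLp (h α I)

end DyadicInterval

open DyadicInterval

/-- The pairing `⟨f, g⟩ = ∫ f g` (also used when `f` is only locally integrable and `g` is one of
the functions `h^α_I`). -/
def pairing (f g : ℝ → ℝ) : ℝ := ∫ x, f x * g x

/-- The sequence `b̂` of Haar coefficients `b̂(I) = ⟨b, h_I⟩` of a function `b`. -/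
def haarCoeff (b : ℝ → ℝ) (I : DyadicInterval) : ℝ := pairing b (h 0 I)

/-- The `I`-th term `b_I ⟨f, h^β_I⟩ h^α_I` of the dyadic paraproduct. -/
def paraproductTerm (α β : Fin 2) (b : DyadicInterval → ℝ) (f : L2R) (I : DyadicInterval) : L2R :=
  (b I * pairing f (h β I)) • hL2 α I

/-- The series defining `P^{(α,β)}_b f` converges (unconditionally) in `L²(ℝ)`. -/
def ParaproductConverges (α β : Fin 2) (b : DyadicInterval → ℝ) (f : L2R) : Prop :=
  Summable (paraproductTerm α β b f)

/-- The dyadic paraproduct `P^{(α,β)}_b f = ∑_I b_I ⟨f, h^β_I⟩ h^α_I`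
(meaningful when `ParaproductConverges α β b f`). -/
def paraproduct (α β : Fin 2) (b : DyadicInterval → ℝ) (f : L2R) : L2R :=
  ∑' I, paraproductTerm α β b f I

/-- The Haar shift `S f = ∑_I ⟨f, h_I⟩ h_{I₋}` on `L²(ℝ)`. The series converges for every `f`,
because both `(h_I)` and `(h_{I₋})` are orthonormal families. -/
def haarShift (f : L2R) : L2R := ∑' I : DyadicInterval, pairing f (h 0 I) • hL2 0 I.left

/-- A weight: a nonnegative locally integrable function on `ℝ`. -/
def IsWeight (ω : ℝ → ℝ) : Prop := (∀ x, 0 ≤ ω x) ∧ LocallyIntegrable ω volume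

/-- The average `⟨u⟩_I = |I|⁻¹ ∫_I u` of a `[0, ∞]`-valued function. -/
def dyadicAverage (u : ℝ → ℝ≥0∞) (I : DyadicInterval) : ℝ≥0∞ :=
  (ENNReal.ofReal I.len)⁻¹ * ∫⁻ x in I.toSet, u x

/-- The (dyadic) `A₂` characteristic `[ω]_{A₂} = sup_I ⟨ω⟩_I ⟨ω⁻¹⟩_I`, a value in `[0, ∞]`;
here `ω⁻¹ = ∞` where `ω = 0`. -/
def A2char (ω : ℝ → ℝ) : ℝ≥0∞ :=
  ⨆ I : DyadicInterval, dyadicAverage (fun x => ENNReal.ofReal (ω x)) I *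
    dyadicAverage (fun x => (ENNReal.ofReal (ω x))⁻¹) I

/-- The sequence `b̂` of Haar coefficients of `b = ω^{1/2}`. -/
def sqrtCoeff (ω : ℝ → ℝ) : DyadicInterval → ℝ := haarCoeff (fun x => √(ω x))

/-- The sequence `ĉ` of Haar coefficients of `c = ω^{-1/2}`. -/
def invSqrtCoeff (ω : ℝ → ℝ) : DyadicInterval → ℝ := haarCoeff (fun x => (√(ω x))⁻¹)

end

noncomputable section

namespace DyadicInterval

open Filter Topology

/-! Write `b = ω^{1/2}`, `c = ω^{-1/2}`, and let `w`, `σ` be the masses of `ω`, `ω⁻¹` on dyadic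
intervals. Multiplication by `c` splits into the two paraproducts with symbol `ĉ` and the diagonal
Haar multiplier by the averages of `c`. Hence the `J`-th Haar coefficient of `P^{(1,0)}_ĉ φ` is the
pairing of `φ` with `c h_J - ⟨c⟩_J h_J - ĉ(J) h¹_J` (`corrHaar`, `inner_paraproduct`), an expression
in the integrals of `c φ`, `φ` and `c` over the halves of `J`. The shift moves this coefficient from
`J` to `J₋`.

The multiplication bound follows by duality: the pairing of `ω^{1/2} S P^{(1,0)}_ĉ φ` with `g` is a
bilinear sum over `J`, estimated in `IsA2Pair.treeSum_innerCoeff_mul_le`. Its core is the form of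
the Haar shift between weighted spaces (`IsA2Pair.treeSum_shift_form_le`). Each coefficient is split
into an average times the increment of the weight, and a fluctuation controlled by orthogonality in
the weighted space. The product of the two average parts is summed by a bilinear Carleson embedding,
which needs the sequence `|Δ_J σ| |Δ_{J₋} w| / |J|` to be Carleson with constant of order `Q`
(`IsA2Pair.treeSum_shift_le`); the other products use Cauchy-Schwarz and the `A₂` condition.
Linearity in `Q` survives because no product meets the factor `Q` twice.

For the outer paraproduct, with `F = S P^{(1,0)}_ĉ φ`, the same splitting, now for multiplication by
`b`, gives `b̂(I) ⟨F, h¹_I⟩ = ⟨b F, h_I⟩ - ⟨b⟩_I ⟨F, h_I⟩ - ⟨F, corrHaar_I⟩`. The first family is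
square summable by the multiplication bound, the second by the weighted square estimate
`sum_coeff_sq_le`, the third by duality and Carleson embedding (`sum_inner_corrHaar_sq_le`).

All weighted inequalities are proved for additive functions of dyadic intervals on finite trees, by
Bellman functions, with bounds independent of the depth; they are then transferred to arbitrary
finite families. Finite Haar sums are dense, so the operator extends. -/

theorem len_pos (I : DyadicInterval) : 0 < I.len := by
  unfold len; positivity

theorem len_left (I : DyadicInterval) : I.left.len = I.len / 2 := by
  simp only [len, left]
  rw [neg_add, zpow_add₀ (by norm_num)]
  norm_num [div_eq_mul_inv]

theorem len_right (I : DyadicInterval) : I.right.len = I.len / 2 := by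
  simp only [len, right]
  rw [neg_add, zpow_add₀ (by norm_num)]
  norm_num [div_eq_mul_inv]

/-- The sum of `θ` over the first `n` generations of dyadic intervals below `I`. -/
def treeSum (θ : DyadicInterval → ℝ) : ℕ → DyadicInterval → ℝ
  | 0, _ => 0
  | n + 1, I => θ I + (treeSum θ n I.left + treeSum θ n I.right)

/-- The difference of the values at the two children. -/
def diff (f : DyadicInterval → ℝ) (I : DyadicInterval) : ℝ := f I.left - f I.right

/-- Finitely additive functions on the dyadic grid. -/
def IsAdditive (f : DyadicInterval → ℝ) : Prop := ∀ I, f I = f I.left + f I.right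

theorem isAdditive_len : IsAdditive len := fun I => by
  rw [len_left, len_right]; ring

/-! ### Finite dyadic tree sums and the Bellman induction -/

section TreeSum

variable {θ η : DyadicInterval → ℝ}

theorem treeSum_nonneg (h : ∀ I, 0 ≤ θ I) (n : ℕ) (I : DyadicInterval) : 0 ≤ treeSum θ n I := by
  induction n generalizing I with
  | zero => exact le_rfl
  | succ n ih => exact add_nonneg (h I) (add_nonneg (ih _) (ih _))

theorem treeSum_mono (h : ∀ I, θ I ≤ η I) (n : ℕ) (I : DyadicInterval) :
    treeSum θ n I ≤ treeSum η n I := by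
  induction n generalizing I with
  | zero => exact le_rfl
  | succ n ih => exact add_le_add (h I) (add_le_add (ih _) (ih _))

theorem treeSum_add (n : ℕ) (I : DyadicInterval) :
    treeSum (fun I => θ I + η I) n I = treeSum θ n I + treeSum η n I := by
  induction n generalizing I with
  | zero => simp [treeSum]
  | succ n ih => simp only [treeSum, ih]; ring

theorem treeSum_const_mul (c : ℝ) (n : ℕ) (I : DyadicInterval) :
    treeSum (fun I => c * θ I) n I = c * treeSum θ n I := by
  induction n generalizing I with
  | zero => simp [treeSum]
  | succ n ih => simp only [treeSum, ih]; ring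

theorem treeSum_comp_left_le (h : ∀ I, 0 ≤ θ I) (n : ℕ) (I : DyadicInterval) :
    treeSum (fun J => θ J.left) n I ≤ treeSum θ (n + 1) I := by
  -- With the root term included the induction closes: the root term of the left subtree absorbs the
  -- new summand `θ I.left`, and that of the right subtree is discarded.
  suffices H : θ I + treeSum (fun J => θ J.left) n I ≤ treeSum θ (n + 1) I by
    linarith [h I]
  induction n generalizing I with
  | zero => simp [treeSum]
  | succ n ih =>
    have h1 := ih I.left
    have h2 := ih I.right
    have h3 := h I.right
    rw [treeSum, treeSum]
    linarith

/-- Bellman's principle: a nonnegative function that pays for `θ` whenever an interval is split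
telescopes down the tree. The Carleson estimates for weights below are obtained from a suitable `B`.
-/
theorem treeSum_le_of_bellman {B : DyadicInterval → ℝ} (hB : ∀ I, 0 ≤ B I)
    (h : ∀ I, θ I + (B I.left + B I.right) ≤ B I) (n : ℕ) (I : DyadicInterval) :
    treeSum θ n I ≤ B I := by
  induction n generalizing I with
  | zero => exact hB I
  | succ n ih => exact (add_le_add le_rfl (add_le_add (ih _) (ih _))).trans (h I)

end TreeSum

/-! ### Carleson sequences attached to an `A₂` pair -/

/-- This is the one-step Bellman inequality of `IsA2Pair.treeSum_diff_sq_div_le`, divided by the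
mass of the interval; `p`, `q` are the relative increments of the two weights. The mean of the two
square roots can exceed 1 when `q` is large, and the last term compensates for this. -/
theorem carleson_real_aux {p q ρ : ℝ} (hp : |p| < 1) (hq : |q| < 1) (hρ : 1 ≤ ρ) :
    p ^ 2 / 16 + ρ * ((√((1 + p) / (1 + q)) + √((1 - p) / (1 - q))) / 2) ≤
      ρ + ρ ^ 2 * (q ^ 2 / (1 - q ^ 2)) := by
  obtain ⟨hp1, hp2⟩ := abs_lt.1 hp
  obtain ⟨hq1, hq2⟩ := abs_lt.1 hq
  have hqq : 0 < 1 - q ^ 2 := by nlinarith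
  set A := √((1 + p) / (1 + q)) with hA
  set D := √((1 - p) / (1 - q)) with hD
  have hA2 : A ^ 2 = (1 + p) / (1 + q) := Real.sq_sqrt (by apply div_nonneg <;> linarith)
  have hD2 : D ^ 2 = (1 - p) / (1 - q) := Real.sq_sqrt (by apply div_nonneg <;> linarith)
  have hAD : A * D * (1 - q ^ 2) ≤ 1 - p ^ 2 / 2 - q ^ 2 / 2 := by
    have h1 : (A * D) ^ 2 * (1 - q ^ 2) = 1 - p ^ 2 := by
      rw [mul_pow, hA2, hD2]
      have : 1 + q ≠ 0 := by linarith
      have : 1 - q ≠ 0 := by linarith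
      field_simp
      ring
    have h2 : (A * D * (1 - q ^ 2)) ^ 2 ≤ (1 - p ^ 2 / 2 - q ^ 2 / 2) ^ 2 := by
      have : (A * D * (1 - q ^ 2)) ^ 2 = (1 - p ^ 2) * (1 - q ^ 2) := by
        rw [← h1]; ring
      rw [this]; nlinarith [sq_nonneg (p ^ 2 - q ^ 2)]
    exact le_of_sq_le_sq h2 (by nlinarith)
  set L := (A + D) / 2 with hL
  have hS : (A ^ 2 + D ^ 2) * (1 - q ^ 2) = 2 - 2 * (p * q) := by
    rw [hA2, hD2]
    have : 1 + q ≠ 0 := by linarith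
    have : 1 - q ≠ 0 := by linarith
    field_simp
    ring
  have hL2 : L ^ 2 * (1 - q ^ 2) ≤ 1 - p * q / 2 - p ^ 2 / 4 - q ^ 2 / 4 := by
    rw [hL]; nlinarith
  -- Since `1 - L ≥ (1 - L ^ 2) / 2`, the bound `hL2` leaves a surplus of at least `(p + 2 q)² / 16
  -- + 3 q² / 8`.
  have hkey : p ^ 2 / 16 - q ^ 2 ≤ (1 - L) * (1 - q ^ 2) := by
    nlinarith [sq_nonneg (1 - L), sq_nonneg (p + 2 * q), sq_nonneg p, sq_nonneg q]
  have hx : 0 ≤ q ^ 2 / (1 - q ^ 2) := by positivity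
  have hkey2 : p ^ 2 / 16 - q ^ 2 / (1 - q ^ 2) ≤ 1 - L := by
    have : (p ^ 2 / 16 - q ^ 2) / (1 - q ^ 2) ≤ 1 - L := by
      rw [div_le_iff₀ hqq]; exact hkey
    have h3 : p ^ 2 / 16 ≤ p ^ 2 / 16 / (1 - q ^ 2) := by
      rw [le_div_iff₀ hqq]; nlinarith [sq_nonneg p, sq_nonneg q, mul_nonneg (sq_nonneg p) (sq_nonneg q)]
    rw [sub_div] at this
    linarith
  -- After multiplying `hkey2` by `ρ`, the condition `ρ ≥ 1` is used twice: to lower `ρ p²` to `p²`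
  -- and to raise `ρ` to `ρ²` in the last term.
  nlinarith [mul_le_mul_of_nonneg_left hkey2 (by linarith : (0:ℝ) ≤ ρ),
    mul_nonneg (by linarith : (0:ℝ) ≤ ρ - 1) (sq_nonneg p),
    mul_nonneg (mul_nonneg (by linarith : (0:ℝ) ≤ ρ) (by linarith : (0:ℝ) ≤ ρ - 1)) hx]

/-- Concavity of the square root with a quantitative gain: squaring produces `√(1 - p²)`, which is
at most `1 - p² / 2`. -/
theorem sqrt_add_sqrt_le {s t : ℝ} (hs : 0 < s) (ht : 0 < t) (l : ℝ) (hl : 0 < l) :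
    √(s * (l / 2)) + √(t * (l / 2)) ≤ √((s + t) * l) * (1 - ((s - t) / (s + t)) ^ 2 / 8) := by
  set p := (s - t) / (s + t) with hp
  have hst : 0 < s + t := by positivity
  have hp2 : p ^ 2 ≤ 1 := by
    rw [hp, div_pow, div_le_one (by positivity)]; nlinarith
  apply le_of_sq_le_sq _ (by have := Real.sqrt_nonneg ((s + t) * l); apply mul_nonneg this; linarith)
  rw [mul_pow, Real.sq_sqrt (by positivity), add_sq, Real.sq_sqrt (by positivity),
    Real.sq_sqrt (by positivity), mul_assoc 2, ← Real.sqrt_mul (by positivity)]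
  have h1 : √(s * (l / 2) * (t * (l / 2))) ≤ (s + t) * l / 4 * (1 - p ^ 2 / 2) := by
    apply Real.sqrt_le_iff.2 ⟨by apply mul_nonneg (by positivity); linarith, ?_⟩
    have : s * (l / 2) * (t * (l / 2)) = ((s + t) * l / 4) ^ 2 * (1 - p ^ 2) := by
      rw [hp]; field_simp; ring
    rw [this, mul_pow]
    apply mul_le_mul_of_nonneg_left _ (by positivity)
    nlinarith [sq_nonneg (p ^ 2)]
  have h2 : 0 < (s + t) * l := by positivity
  nlinarith [mul_nonneg h2.le (sq_nonneg (p ^ 2))]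

theorem sqrt_mul_add_sqrt_mul_le {a b c d : ℝ} (ha : 0 ≤ a) (hb : 0 ≤ b) (hc : 0 ≤ c)
    (hd : 0 ≤ d) : √(a * b) + √(c * d) ≤ √((a + c) * (b + d)) := by
  apply Real.le_sqrt_of_sq_le
  rw [add_sq, Real.sq_sqrt (by positivity), Real.sq_sqrt (by positivity), mul_assoc 2,
    ← Real.sqrt_mul (by positivity)]
  have : √(a * b * (c * d)) ≤ (a * d + b * c) / 2 := by
    apply Real.sqrt_le_iff.2 ⟨by positivity, ?_⟩
    nlinarith [sq_nonneg (a * d - b * c)]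
  nlinarith

/-- The geometric mean `E` is itself the Bellman function, up to the factor `16 κ³`. The gain `π² /
8` in `a` becomes a gain `π² / 16` in `E`, and `E ≤ κ |J|` turns `E⁴ / |J|³` into at most `κ³ E`.
The fourth power allows `E` to be a fourth root of a polynomial in the masses. -/
theorem treeSum_sqrt_bellman {a d E π : DyadicInterval → ℝ} {κ : ℝ} (hκ : 0 ≤ κ)
    (ha : ∀ I, 0 ≤ a I) (hd : ∀ I, 0 ≤ d I) (hE : ∀ I, E I = √(a I * d I))
    (hEκ : ∀ I, E I ≤ κ * I.len) (hdd : ∀ I, d I.left + d I.right ≤ d I)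
    (haa : ∀ I, a I.left + a I.right ≤ a I * (1 - π I ^ 2 / 8)) (hπ : ∀ I, π I ^ 2 ≤ 1)
    (n : ℕ) (I : DyadicInterval) :
    treeSum (fun J => π J ^ 2 * (E J ^ 4 / J.len ^ 3)) n I ≤ 16 * κ ^ 4 * I.len := by
  have hE0 : ∀ I, 0 ≤ E I := fun I => by rw [hE]; exact Real.sqrt_nonneg _
  have key := treeSum_le_of_bellman (θ := fun J => π J ^ 2 * (E J ^ 4 / J.len ^ 3))
    (B := fun J => 16 * κ ^ 3 * E J) (fun J => by have := hE0 J; positivity) ?_ n I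
  · refine key.trans ?_
    have := mul_le_mul_of_nonneg_left (hEκ I) (by positivity : 0 ≤ 16 * κ ^ 3)
    calc _ ≤ _ := this
      _ = _ := by ring
  intro J
  have h1 : E J.left + E J.right ≤ E J * (1 - π J ^ 2 / 16) := by
    rw [hE, hE, hE]
    refine (sqrt_mul_add_sqrt_mul_le (ha _) (hd _) (ha _) (hd _)).trans ?_
    have h2 : (1 - π J ^ 2 / 16) = √((1 - π J ^ 2 / 16) ^ 2) :=
      (Real.sqrt_sq (by linarith [hπ J])).symm
    rw [h2, ← Real.sqrt_mul (mul_nonneg (ha _) (hd _))]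
    apply Real.sqrt_le_sqrt
    calc (a J.left + a J.right) * (d J.left + d J.right)
        ≤ (a J * (1 - π J ^ 2 / 8)) * d J :=
          mul_le_mul (haa J) (hdd J) (add_nonneg (hd _) (hd _))
            (mul_nonneg (ha _) (by linarith [hπ J]))
      _ = (a J * d J) * (1 - π J ^ 2 / 8) := by ring
      _ ≤ _ := mul_le_mul_of_nonneg_left (by nlinarith [sq_nonneg (π J ^ 2)])
            (mul_nonneg (ha _) (hd _))
  have hl := J.len_pos
  have h3 : E J ^ 4 / J.len ^ 3 ≤ κ ^ 3 * E J := by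
    rw [div_le_iff₀ (by positivity)]
    have := pow_le_pow_left₀ (hE0 J) (hEκ J) 3
    have := mul_le_mul_of_nonneg_left this (hE0 J)
    calc E J ^ 4 = E J * E J ^ 3 := by ring
      _ ≤ _ := this
      _ = _ := by ring
  have h4 := mul_le_mul_of_nonneg_left h3 (sq_nonneg (π J))
  have h5 := mul_le_mul_of_nonneg_left h1 (by positivity : 0 ≤ 16 * κ ^ 3)
  nlinarith

section A2Pair

/-- The masses `σ`, `w` of a pair of dual weights with `A₂` characteristic at most `Q`. -/
structure IsA2Pair (Q : ℝ) (σ w : DyadicInterval → ℝ) : Prop where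
  one_le : 1 ≤ Q
  pos_left : ∀ I, 0 < σ I
  pos_right : ∀ I, 0 < w I
  add_left : IsAdditive σ
  add_right : IsAdditive w
  sq_len_le : ∀ I, I.len ^ 2 ≤ σ I * w I
  le_sq_len : ∀ I, σ I * w I ≤ Q * I.len ^ 2

variable {Q : ℝ} {σ w : DyadicInterval → ℝ}

theorem IsA2Pair.symm (h : IsA2Pair Q σ w) : IsA2Pair Q w σ where
  one_le := h.one_le
  pos_left := h.pos_right
  pos_right := h.pos_left
  add_left := h.add_right
  add_right := h.add_left
  sq_len_le := fun I => (h.sq_len_le I).trans_eq (mul_comm _ _)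
  le_sq_len := fun I => (mul_comm _ _).trans_le (h.le_sq_len I)

theorem abs_diff_lt {f : DyadicInterval → ℝ} (hf : ∀ I, 0 < f I) (hadd : IsAdditive f)
    (I : DyadicInterval) : |diff f I| < f I := by
  rw [abs_lt, diff, hadd I]
  constructor <;> linarith [hf I.left, hf I.right]

theorem diff_sq_le {f : DyadicInterval → ℝ} (hf : ∀ I, 0 < f I) (hadd : IsAdditive f)
    (I : DyadicInterval) : diff f I ^ 2 ≤ f I ^ 2 :=
  sq_le_sq.2 ((abs_diff_lt hf hadd I).le.trans (le_abs_self _))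

theorem diff_div_sq_le_one {f : DyadicInterval → ℝ} (hf : ∀ I, 0 < f I) (hadd : IsAdditive f)
    (I : DyadicInterval) : (diff f I / f I) ^ 2 ≤ 1 := by
  rw [div_pow, div_le_one (pow_pos (hf I) 2)]
  exact diff_sq_le hf hadd I

theorem sqrt_len_bellman {f : DyadicInterval → ℝ} (hf : ∀ I, 0 < f I) (hadd : IsAdditive f)
    (I : DyadicInterval) :
    √(f I.left * I.left.len) + √(f I.right * I.right.len) ≤
      √(f I * I.len) * (1 - (diff f I / f I) ^ 2 / 8) := by
  rw [len_left, len_right, hadd I]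
  exact sqrt_add_sqrt_le (hf _) (hf _) _ I.len_pos

/-- The Bellman function `√Q |J| √(σ/w) + Q (σ - |J|²/w)` lies between 0 and `2 Q σ`, because `|J|²
≤ σ w`. Its first term gains from increments of `σ`; its second pays for what the first loses
through increments of `w`. Division by `σ J` reduces the step to `carleson_real_aux` with `ρ² = Q
|J|² / (σ w)`. -/
theorem IsA2Pair.treeSum_diff_sq_div_le (h : IsA2Pair Q σ w) (n : ℕ) (I : DyadicInterval) :
    treeSum (fun J => diff σ J ^ 2 / σ J) n I ≤ 32 * Q * σ I := by
  have hQ := h.one_le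
  have key := treeSum_le_of_bellman (θ := fun J => (1 / 16) * (diff σ J ^ 2 / σ J))
    (B := fun J => √Q * (J.len * √(σ J / w J)) + Q * (σ J - J.len ^ 2 / w J)) ?_ ?_ n I
  · rw [treeSum_const_mul] at key
    have hl := I.len_pos
    have hs := h.pos_left I
    have hw := h.pos_right I
    have h1 : I.len * √(σ I / w I) ≤ σ I := by
      rw [← Real.sqrt_sq hl.le, ← Real.sqrt_mul (by positivity)]
      apply Real.sqrt_le_iff.2 ⟨hs.le, ?_⟩
      rw [mul_div_assoc', div_le_iff₀ hw]
      nlinarith [h.sq_len_le I]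
    have h2 : √Q ≤ Q := Real.sqrt_le_iff.2 ⟨by linarith, by nlinarith⟩
    have h3 : 0 ≤ I.len ^ 2 / w I := by positivity
    have h4 : √Q * (I.len * √(σ I / w I)) ≤ Q * σ I :=
      mul_le_mul h2 h1 (by positivity) (by linarith)
    nlinarith
  · intro J
    have hl := J.len_pos
    have : J.len ^ 2 / w J ≤ σ J := (div_le_iff₀ (h.pos_right J)).2 (h.sq_len_le J)
    have : 0 ≤ σ J - J.len ^ 2 / w J := by linarith
    positivity
  · intro J
    have hl := J.len_pos
    have hs := h.pos_left J
    have hw := h.pos_right J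
    set p := diff σ J / σ J with hp
    set q := diff w J / w J with hq
    have hp1 : |p| < 1 := by
      rw [hp, abs_div, abs_of_pos hs, div_lt_one hs]; exact abs_diff_lt h.pos_left h.add_left J
    have hq1 : |q| < 1 := by
      rw [hq, abs_div, abs_of_pos hw, div_lt_one hw]; exact abs_diff_lt h.pos_right h.add_right J
    obtain ⟨hp2, hp3⟩ := abs_lt.1 hp1
    obtain ⟨hq2, hq3⟩ := abs_lt.1 hq1
    have e1 : σ J.left = σ J * (1 + p) / 2 := by
      rw [hp, diff]; field_simp; rw [h.add_left J]; ring
    have e2 : σ J.right = σ J * (1 - p) / 2 := by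
      rw [hp, diff]; field_simp; rw [h.add_left J]; ring
    have e3 : w J.left = w J * (1 + q) / 2 := by
      rw [hq, diff]; field_simp; rw [h.add_right J]; ring
    have e4 : w J.right = w J * (1 - q) / 2 := by
      rw [hq, diff]; field_simp; rw [h.add_right J]; ring
    have e5 : diff σ J ^ 2 / σ J = σ J * p ^ 2 := by rw [hp]; field_simp
    set ρ := √(Q * J.len ^ 2 / (σ J * w J)) with hρ
    have hρ1 : 1 ≤ ρ := by
      rw [hρ, Real.one_le_sqrt, one_le_div (by positivity)]
      exact h.le_sq_len J
    have hρ2 : ρ ^ 2 = Q * J.len ^ 2 / (σ J * w J) := Real.sq_sqrt (by positivity)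
    have main := carleson_real_aux hp1 hq1 hρ1
    have hsq : √Q * (J.len * √(σ J / w J)) = ρ * σ J := by
      rw [hρ]
      conv_lhs => rw [← Real.sqrt_sq hl.le, ← Real.sqrt_mul (by positivity),
        ← Real.sqrt_mul (by positivity)]
      conv_rhs => rw [← Real.sqrt_sq hs.le, ← Real.sqrt_mul (by positivity)]
      congr 1
      rw [Real.sqrt_sq hs.le]
      field_simp
    have d1 : √(σ J.left / w J.left) = √(σ J / w J) * √((1 + p) / (1 + q)) := by
      rw [← Real.sqrt_mul (by positivity), e1, e3]
      congr 1
      have : 1 + q ≠ 0 := by linarith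
      field_simp
    have d2 : √(σ J.right / w J.right) = √(σ J / w J) * √((1 - p) / (1 - q)) := by
      rw [← Real.sqrt_mul (by positivity), e2, e4]
      congr 1
      have : 1 - q ≠ 0 := by linarith
      field_simp
    have d3 : (J.len / 2) ^ 2 / w J.left + (J.len / 2) ^ 2 / w J.right =
        J.len ^ 2 / w J + J.len ^ 2 / w J * (q ^ 2 / (1 - q ^ 2)) := by
      rw [e3, e4]
      have : 1 - q ≠ 0 := by linarith
      have : 1 + q ≠ 0 := by linarith
      have h6 : 1 - q ^ 2 = (1 - q) * (1 + q) := by ring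
      rw [h6]
      field_simp
      ring
    have d4 : Q * (J.len ^ 2 / w J) = σ J * ρ ^ 2 := by rw [hρ2]; field_simp
    simp only [len_left, len_right]
    rw [d1, d2, e5]
    have m2 := mul_le_mul_of_nonneg_left main hs.le
    have hadd := h.add_left J
    have i1 : √Q * (J.len / 2 * (√(σ J / w J) * √((1 + p) / (1 + q)))) =
        ρ * σ J * (√((1 + p) / (1 + q)) / 2) := by rw [← hsq]; ring
    have i2 : √Q * (J.len / 2 * (√(σ J / w J) * √((1 - p) / (1 - q)))) =
        ρ * σ J * (√((1 - p) / (1 - q)) / 2) := by rw [← hsq]; ring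
    rw [i1, i2, hsq]
    have i3 : Q * (σ J.left - (J.len / 2) ^ 2 / w J.left) +
        Q * (σ J.right - (J.len / 2) ^ 2 / w J.right) =
        Q * σ J - σ J * ρ ^ 2 - σ J * ρ ^ 2 * (q ^ 2 / (1 - q ^ 2)) := by
      rw [← d4, hadd]; linear_combination (-Q) * d3
    have i4 : Q * (σ J - J.len ^ 2 / w J) = Q * σ J - σ J * ρ ^ 2 := by rw [← d4]; ring
    rw [i4]
    linarith

/-- Here `E = (σ w |J|²)^{1/4}`, the geometric mean of `√(σ |J|)` and `√(w |J|)`; the `A₂` condition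
gives `E⁴ ≤ Q |J|⁴`, whence `κ = Q^{1/4}`. -/
theorem IsA2Pair.treeSum_diff_sq_mul_le (h : IsA2Pair Q σ w) (n : ℕ) (I : DyadicInterval) :
    treeSum (fun J => diff σ J ^ 2 * w J / (σ J * J.len)) n I ≤ 16 * Q * I.len := by
  have hQ := h.one_le
  have hκ : √√Q ^ 4 = Q := by
    rw [show √√Q ^ 4 = (√√Q ^ 2) ^ 2 by ring, Real.sq_sqrt (by positivity),
      Real.sq_sqrt (by positivity)]
  have hE : ∀ J, √(√(σ J * J.len) * √(w J * J.len)) ^ 4 = σ J * w J * J.len ^ 2 := fun J => by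
    have := J.len_pos; have := h.pos_left J; have := h.pos_right J
    rw [show ∀ x : ℝ, x ^ 4 = (x ^ 2) ^ 2 by intro x; ring, Real.sq_sqrt (by positivity), mul_pow,
      Real.sq_sqrt (by positivity), Real.sq_sqrt (by positivity)]
    ring
  have key := treeSum_sqrt_bellman (κ := √√Q) (a := fun J => √(σ J * J.len))
    (d := fun J => √(w J * J.len)) (E := fun J => √(√(σ J * J.len) * √(w J * J.len)))
    (π := fun J => diff σ J / σ J) (by positivity)
    (fun J => Real.sqrt_nonneg _) (fun J => Real.sqrt_nonneg _) (fun J => rfl) ?_ ?_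
    (sqrt_len_bellman h.pos_left h.add_left) (diff_div_sq_le_one h.pos_left h.add_left) n I
  · rw [hκ] at key
    refine le_trans (treeSum_mono (fun J => ?_) n I) key
    simp only [hE]
    have := J.len_pos; have := h.pos_left J; have := h.pos_right J
    apply le_of_eq
    field_simp
  · intro J
    have hl := J.len_pos
    apply le_of_pow_le_pow_left₀ (n := 4) (by norm_num) (by positivity)
    rw [hE, mul_pow, hκ]
    nlinarith [mul_le_mul_of_nonneg_right (h.le_sq_len J) (sq_nonneg J.len)]
  · intro J
    refine (sqrt_len_bellman h.pos_right h.add_right J).trans ?_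
    exact mul_le_of_le_one_right (Real.sqrt_nonneg _)
      (by nlinarith [sq_nonneg (diff w J / w J)])

/-- The analogue for the integrals `v` of the square root of a weight. Now `E = (v² w |J|)^{1/4}`,
the geometric mean of `√(v |J|)`, which gains by concavity, and `√(v w)`, which does not increase
under splitting by Cauchy-Schwarz. -/
theorem IsA2Pair.treeSum_diff_sqrt_sq_mul_le (h : IsA2Pair Q σ w) {v : DyadicInterval → ℝ}
    (hv : ∀ I, 0 < v I) (hadd : IsAdditive v) (hvσ : ∀ I, v I ^ 2 ≤ σ I * I.len)
    (n : ℕ) (I : DyadicInterval) :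
    treeSum (fun J => diff v J ^ 2 * w J / J.len ^ 2) n I ≤ 16 * Q * I.len := by
  have hQ := h.one_le
  have hκ : √√Q ^ 4 = Q := by
    rw [show √√Q ^ 4 = (√√Q ^ 2) ^ 2 by ring, Real.sq_sqrt (by positivity),
      Real.sq_sqrt (by positivity)]
  have hE : ∀ J, √(√(v J * J.len) * √(v J * w J)) ^ 4 = v J ^ 2 * w J * J.len := fun J => by
    have := J.len_pos; have := hv J; have := h.pos_right J
    rw [show ∀ x : ℝ, x ^ 4 = (x ^ 2) ^ 2 by intro x; ring, Real.sq_sqrt (by positivity), mul_pow,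
      Real.sq_sqrt (by positivity), Real.sq_sqrt (by positivity)]
    ring
  have key := treeSum_sqrt_bellman (κ := √√Q) (a := fun J => √(v J * J.len))
    (d := fun J => √(v J * w J)) (E := fun J => √(√(v J * J.len) * √(v J * w J)))
    (π := fun J => diff v J / v J) (by positivity)
    (fun J => Real.sqrt_nonneg _) (fun J => Real.sqrt_nonneg _) (fun J => rfl) ?_ ?_
    (sqrt_len_bellman hv hadd) (diff_div_sq_le_one hv hadd) n I
  · rw [hκ] at key
    refine le_trans (treeSum_mono (fun J => ?_) n I) key
    simp only [hE]
    have := J.len_pos; have := hv J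
    apply le_of_eq
    field_simp
  · intro J
    have hl := J.len_pos
    apply le_of_pow_le_pow_left₀ (n := 4) (by norm_num) (by positivity)
    rw [hE, mul_pow, hκ]
    have h1 := mul_le_mul_of_nonneg_right (hvσ J) (h.pos_right J).le
    have h2 := mul_le_mul_of_nonneg_right (h.le_sq_len J) hl.le
    have h3 : v J ^ 2 * w J ≤ Q * J.len ^ 3 := by nlinarith
    nlinarith [mul_le_mul_of_nonneg_right h3 hl.le]
  · intro J
    refine (sqrt_mul_add_sqrt_mul_le (hv _).le (h.pos_right _).le (hv _).le
      (h.pos_right _).le).trans_eq ?_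
    rw [← hadd, ← h.add_right]

end A2Pair

/-! ### The bilinear Carleson embedding theorem -/

/-- `F² ≤ y μ` for nonnegative additive `F`, `y`: the situation of `F I = ∫_I |φ| dμ` and
`y I = ∫_I φ² dμ`. -/
structure IsSqDominated (μ F y : DyadicInterval → ℝ) : Prop where
  nonneg : ∀ I, 0 ≤ F I
  add_left : IsAdditive F
  add_right : IsAdditive y
  sq_le : ∀ I, F I ^ 2 ≤ y I * μ I

theorem IsSqDominated.nonneg_right {μ F y : DyadicInterval → ℝ} (h : IsSqDominated μ F y)
    (hμ : ∀ I, 0 < μ I) (I : DyadicInterval) : 0 ≤ y I :=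
  nonneg_of_mul_nonneg_left ((sq_nonneg _).trans (h.sq_le I)) (hμ I)

/-- The induction carries running maxima `s`, `t` of the averages `F/μ`, `G/ν` along the ancestors.
The term with `treeSum a - A ρ` is the unspent Carleson budget, which is nonpositive; the quadratic
terms form the Bellman function of the `L²` bound for the dyadic maximal function. The second
alternative in `hMN` allows averages over the left child, as the Haar shift requires, provided `a I`
fits into the budget of that child. -/
theorem treeSum_bilinear_aux {ρ μ ν F G y z a θ M N : DyadicInterval → ℝ} {A : ℝ} (hA : 0 ≤ A)
    (hμ : ∀ I, 0 < μ I) (hν : ∀ I, 0 < ν I)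
    (hρadd : IsAdditive ρ) (hμadd : IsAdditive μ) (hνadd : IsAdditive ν)
    (hρμν : ∀ I, ρ I ^ 2 ≤ μ I * ν I) (hF : IsSqDominated μ F y) (hG : IsSqDominated ν G z)
    (ha : ∀ I, 0 ≤ a I) (haA : ∀ n I, treeSum a n I ≤ A * ρ I)
    (hN0 : ∀ I, 0 ≤ N I)
    (hθ : ∀ I, θ I ≤ a I * (M I * N I))
    (hMN : ∀ I, (M I ≤ F I / μ I ∧ N I ≤ G I / ν I) ∨
      ((∀ n, a I + treeSum a n I.left ≤ A * ρ I.left) ∧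
        M I ≤ max (F I / μ I) (F I.left / μ I.left) ∧
        N I ≤ max (G I / ν I) (G I.left / ν I.left)))
    (n : ℕ) (I : DyadicInterval) (s t : ℝ) (hs : F I / μ I ≤ s) (ht : G I / ν I ≤ t) :
    treeSum θ n I ≤ (treeSum a n I - A * ρ I) * (s * t) +
      A / 2 * ((4 * y I - 4 * F I * s + 2 * s ^ 2 * μ I) +
        (4 * z I - 4 * G I * t + 2 * t ^ 2 * ν I)) := by
  -- At the leaves the quadratic term must dominate `s² μ`; the difference is a perfect square once
  -- multiplied by `μ`.
  have hleaf : ∀ {μ F y : DyadicInterval → ℝ}, (∀ I, 0 < μ I) → IsSqDominated μ F y →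
      ∀ I (s : ℝ), s ^ 2 * μ I ≤ 4 * y I - 4 * F I * s + 2 * s ^ 2 * μ I := by
    intro μ F y hμ hF I s
    have h1 := hF.sq_le I
    have h2 := hμ I
    have h3 : 0 ≤ (4 * y I - 4 * F I * s + s ^ 2 * μ I) * μ I := by
      nlinarith [sq_nonneg (s * μ I - 2 * F I)]
    have := nonneg_of_mul_nonneg_left h3 h2
    linarith
  -- Raising `s` to the average moves it to the minimiser of the quadratic, so updating the maximum
  -- never costs anything.
  have hstep : ∀ {μ F y : DyadicInterval → ℝ}, (∀ I, 0 < μ I) → IsSqDominated μ F y →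
      ∀ I (s : ℝ), -4 * F I * max s (F I / μ I) + 2 * (max s (F I / μ I)) ^ 2 * μ I ≤
        -4 * F I * s + 2 * s ^ 2 * μ I := by
    intro μ F y hμ hF I s
    rcases le_total (F I / μ I) s with h | h
    · rw [max_eq_left h]
    · rw [max_eq_right h]
      have hm := hμ I
      set m := F I / μ I with hm'
      have : F I = m * μ I := by rw [hm']; field_simp
      rw [this]
      nlinarith [mul_nonneg (sq_nonneg (s - m)) hm.le]
  induction n generalizing I s t with
  | zero =>
    have h1 := hleaf hμ hF I s
    have h2 := hleaf hν hG I t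
    have hs0 : 0 ≤ s := (div_nonneg (hF.nonneg I) (hμ I).le).trans hs
    have ht0 : 0 ≤ t := (div_nonneg (hG.nonneg I) (hν I).le).trans ht
    have h3 : 2 * (ρ I * (s * t)) ≤ s ^ 2 * μ I + t ^ 2 * ν I := by
      have := hμ I
      have := hν I
      apply le_of_sq_le_sq _ (by positivity)
      have := mul_le_mul_of_nonneg_left (hρμν I) (by positivity : 0 ≤ (s * t) ^ 2)
      nlinarith [sq_nonneg (s ^ 2 * μ I - t ^ 2 * ν I)]
    simp only [treeSum]
    nlinarith
  | succ n ih =>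
    have hs0 : 0 ≤ s := (div_nonneg (hF.nonneg I) (hμ I).le).trans hs
    have ht0 : 0 ≤ t := (div_nonneg (hG.nonneg I) (hν I).le).trans ht
    have hl := ih I.left (max s (F I.left / μ I.left)) (max t (G I.left / ν I.left))
      (le_max_right _ _) (le_max_right _ _)
    have hr := ih I.right (max s (F I.right / μ I.right)) (max t (G I.right / ν I.right))
      (le_max_right _ _) (le_max_right _ _)
    have l1 := hstep hμ hF I.left s
    have l2 := hstep hν hG I.left t
    have r1 := hstep hμ hF I.right s
    have r2 := hstep hν hG I.right t
    have hr3 : (treeSum a n I.right - A * ρ I.right) *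
        (max s (F I.right / μ I.right) * max t (G I.right / ν I.right)) ≤
        (treeSum a n I.right - A * ρ I.right) * (s * t) :=
      mul_le_mul_of_nonpos_left (mul_le_mul (le_max_left _ _) (le_max_left _ _) ht0
        (hs0.trans (le_max_left _ _))) (by linarith [haA n I.right])
    have hl3 : θ I + (treeSum a n I.left - A * ρ I.left) *
        (max s (F I.left / μ I.left) * max t (G I.left / ν I.left)) ≤
        (a I + treeSum a n I.left - A * ρ I.left) * (s * t) := by
      rcases hMN I with ⟨h1, h2⟩ | ⟨h0, h1, h2⟩
      · have h3 : θ I ≤ a I * (s * t) := (hθ I).trans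
          (mul_le_mul_of_nonneg_left (mul_le_mul (h1.trans hs) (h2.trans ht) (hN0 I) hs0) (ha I))
        have h4 : (treeSum a n I.left - A * ρ I.left) *
          (max s (F I.left / μ I.left) * max t (G I.left / ν I.left)) ≤
          (treeSum a n I.left - A * ρ I.left) * (s * t) :=
          mul_le_mul_of_nonpos_left (mul_le_mul (le_max_left _ _) (le_max_left _ _) ht0
            (hs0.trans (le_max_left _ _))) (by linarith [haA n I.left])
        linarith
      -- The term is charged at the updated maxima of the left child. Adding it to that child's
      -- budget keeps the coefficient nonpositive, so the maxima may then be lowered to `s`, `t`.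
      · have h3 : θ I ≤ a I * (max s (F I.left / μ I.left) * max t (G I.left / ν I.left)) :=
          (hθ I).trans (mul_le_mul_of_nonneg_left (mul_le_mul (h1.trans (max_le_max_right _ hs))
            (h2.trans (max_le_max_right _ ht)) (hN0 I) (hs0.trans (le_max_left _ _))) (ha I))
        have h4 : (a I + treeSum a n I.left - A * ρ I.left) *
          (max s (F I.left / μ I.left) * max t (G I.left / ν I.left)) ≤
          (a I + treeSum a n I.left - A * ρ I.left) * (s * t) :=
          mul_le_mul_of_nonpos_left (mul_le_mul (le_max_left _ _) (le_max_left _ _) ht0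
            (hs0.trans (le_max_left _ _))) (by linarith [h0 n])
        linarith
    simp only [treeSum]
    rw [hρadd I, hμadd I, hνadd I, hF.add_left I, hF.add_right I, hG.add_left I, hG.add_right I]
    have l1' := mul_le_mul_of_nonneg_left (add_le_add l1 l2) (by positivity : 0 ≤ A / 2)
    have r1' := mul_le_mul_of_nonneg_left (add_le_add r1 r2) (by positivity : 0 ≤ A / 2)
    linarith

/-- Starting from the averages of the root itself, every term of the Bellman function except those
in `y`, `z` is nonpositive, which leaves `A / 2 * 4`. -/
theorem treeSum_bilinear_le {ρ μ ν F G y z a θ M N : DyadicInterval → ℝ} {A : ℝ} (hA : 0 ≤ A)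
    (hμ : ∀ I, 0 < μ I) (hν : ∀ I, 0 < ν I)
    (hρadd : IsAdditive ρ) (hμadd : IsAdditive μ) (hνadd : IsAdditive ν)
    (hρμν : ∀ I, ρ I ^ 2 ≤ μ I * ν I) (hF : IsSqDominated μ F y) (hG : IsSqDominated ν G z)
    (ha : ∀ I, 0 ≤ a I) (haA : ∀ n I, treeSum a n I ≤ A * ρ I)
    (hN0 : ∀ I, 0 ≤ N I)
    (hθ : ∀ I, θ I ≤ a I * (M I * N I))
    (hMN : ∀ I, (M I ≤ F I / μ I ∧ N I ≤ G I / ν I) ∨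
      ((∀ n, a I + treeSum a n I.left ≤ A * ρ I.left) ∧
        M I ≤ max (F I / μ I) (F I.left / μ I.left) ∧
        N I ≤ max (G I / ν I) (G I.left / ν I.left)))
    (n : ℕ) (I : DyadicInterval) : treeSum θ n I ≤ 2 * A * (y I + z I) := by
  refine (treeSum_bilinear_aux hA hμ hν hρadd hμadd hνadd hρμν hF hG ha haA hN0 hθ hMN n I
    _ _ le_rfl le_rfl).trans ?_
  have hm := hμ I
  have hn := hν I
  have hf := hF.nonneg I
  have hg := hG.nonneg I
  have h1 : (treeSum a n I - A * ρ I) * (F I / μ I * (G I / ν I)) ≤ 0 :=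
    mul_nonpos_of_nonpos_of_nonneg (by linarith [haA n I]) (by positivity)
  have h2 : -4 * F I * (F I / μ I) + 2 * (F I / μ I) ^ 2 * μ I ≤ 0 := by
    have : -4 * F I * (F I / μ I) + 2 * (F I / μ I) ^ 2 * μ I = -(2 * F I ^ 2 / μ I) := by
      field_simp; ring
    rw [this]; have : 0 ≤ 2 * F I ^ 2 / μ I := by positivity
    linarith
  have h3 : -4 * G I * (G I / ν I) + 2 * (G I / ν I) ^ 2 * ν I ≤ 0 := by
    have : -4 * G I * (G I / ν I) + 2 * (G I / ν I) ^ 2 * ν I = -(2 * G I ^ 2 / ν I) := by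
      field_simp; ring
    rw [this]; have : 0 ≤ 2 * G I ^ 2 / ν I := by positivity
    linarith
  have h4 := mul_le_mul_of_nonneg_left (add_le_add h2 h3) (by positivity : 0 ≤ A / 2)
  linarith

/-- The weighted Carleson embedding theorem. -/
theorem treeSum_carleson_le {μ F y a : DyadicInterval → ℝ} {A : ℝ} (hA : 0 ≤ A)
    (hμ : ∀ I, 0 < μ I) (hμadd : IsAdditive μ) (hF : IsSqDominated μ F y)
    (ha : ∀ I, 0 ≤ a I) (haA : ∀ n I, treeSum a n I ≤ A * μ I)
    (n : ℕ) (I : DyadicInterval) :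
    treeSum (fun J => a J * (F J / μ J) ^ 2) n I ≤ 4 * A * y I := by
  have h0 : ∀ J, 0 ≤ F J / μ J := fun J => div_nonneg (hF.nonneg J) (hμ J).le
  have := treeSum_bilinear_le (M := fun J => F J / μ J) (N := fun J => F J / μ J)
    (θ := fun J => a J * (F J / μ J) ^ 2) hA hμ hμ hμadd hμadd hμadd
    (fun I => (sq _).le) hF hF ha haA h0 (fun J => (by rw [sq])) (fun J => Or.inl ⟨le_rfl, le_rfl⟩)
    n I
  linarith

/-- Carleson embedding with respect to Lebesgue measure, with averages over left children. -/
theorem treeSum_carleson_left_le {F y a : DyadicInterval → ℝ} {A : ℝ} (hA : 0 ≤ A)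
    (hF : IsSqDominated len F y)
    (ha : ∀ I, 0 ≤ a I) (haA : ∀ n I, treeSum a n I ≤ A * I.len)
    (n : ℕ) (I : DyadicInterval) :
    treeSum (fun J => a J * (F J.left / J.left.len) ^ 2) n I ≤ 8 * A * y I := by
  have h0 : ∀ J, 0 ≤ F J / J.len := fun J => div_nonneg (hF.nonneg J) (len_pos J).le
  -- The constant `A` is doubled because each term is charged to the left child, whose length is
  -- half that of its parent.
  have := treeSum_bilinear_le (M := fun J => F J.left / J.left.len)
    (N := fun J => F J.left / J.left.len) (A := 2 * A)
    (θ := fun J => a J * (F J.left / J.left.len) ^ 2) (by linarith)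
    len_pos len_pos isAdditive_len isAdditive_len isAdditive_len
    (fun I => (sq _).le) hF hF ha (fun n I => (haA n I).trans (by nlinarith [len_pos I]))
    (fun J => h0 _) (fun J => (by rw [sq]))
    (fun J => Or.inr ⟨fun n => ?_, le_max_right _ _, le_max_right _ _⟩) n I
  · linarith
  · have h1 := haA (n + 1) J
    have h2 := treeSum_nonneg ha n J.right
    rw [treeSum] at h1
    rw [len_left]
    linarith

/-! ### Estimates for Haar coefficients of `f μ` -/

/-- The weighted Haar energy of the signed measure `f` relative to `μ` on one interval. -/
def energy (μ f : DyadicInterval → ℝ) (I : DyadicInterval) : ℝ :=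
  μ I.left * μ I.right / μ I * (f I.left / μ I.left - f I.right / μ I.right) ^ 2

/-- A signed additive `f`, dominated by `F` with `F² ≤ y μ`. -/
structure IsTest (μ f F y : DyadicInterval → ℝ) : Prop extends IsSqDominated μ F y where
  add : IsAdditive f
  abs_le : ∀ I, |f I| ≤ F I

section Energy

variable {μ f F y : DyadicInterval → ℝ}

theorem energy_nonneg (hμ : ∀ I, 0 < μ I) (I : DyadicInterval) : 0 ≤ energy μ f I := by
  have := hμ I; have := hμ I.left; have := hμ I.right
  unfold energy; positivity

/-- Orthogonality of the weighted Haar functions: `y - f² / μ` plays the role of a variance, and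
splitting an interval lowers it by exactly the energy. -/
theorem treeSum_energy_le (hμ : ∀ I, 0 < μ I) (hμadd : IsAdditive μ) (h : IsTest μ f F y)
    (n : ℕ) (I : DyadicInterval) : treeSum (energy μ f) n I ≤ y I := by
  refine (treeSum_le_of_bellman (B := fun I => y I - f I ^ 2 / μ I) (fun J => ?_) (fun J => ?_)
    n I).trans ?_
  · have : f J ^ 2 / μ J ≤ y J := (div_le_iff₀ (hμ J)).2
      ((sq_le_sq.2 ((h.abs_le J).trans (le_abs_self _))).trans (h.sq_le J))
    linarith
  · have h1 := hμ J.left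
    have h2 := hμ J.right
    have h3 : μ J.left + μ J.right ≠ 0 := by positivity
    apply le_of_eq
    simp only [energy]
    rw [hμadd J, h.add J, h.add_right J]
    field_simp
    ring
  · have := hμ I
    have : 0 ≤ f I ^ 2 / μ I := by positivity
    linarith

/-- The part of a Haar coefficient controlled by the energy. -/
def fluct (μ f : DyadicInterval → ℝ) (I : DyadicInterval) : ℝ :=
  2 * (μ I.left * μ I.right) / μ I * |f I.left / μ I.left - f I.right / μ I.right|

theorem fluct_nonneg (hμ : ∀ I, 0 < μ I) (I : DyadicInterval) : 0 ≤ fluct μ f I := by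
  have := hμ I; have := hμ I.left; have := hμ I.right
  unfold fluct; positivity

theorem fluct_sq_div_le (hμ : ∀ I, 0 < μ I) (hμadd : IsAdditive μ) (I : DyadicInterval) :
    fluct μ f I ^ 2 / μ I ≤ energy μ f I := by
  have h0 := hμ I; have h1 := hμ I.left; have h2 := hμ I.right
  have h3 : 4 * (μ I.left * μ I.right) / μ I ^ 2 ≤ 1 := by
    rw [div_le_one (by positivity), hμadd I]; nlinarith [sq_nonneg (μ I.left - μ I.right)]
  have h4 := energy_nonneg (f := f) hμ I
  have : fluct μ f I ^ 2 / μ I = energy μ f I * (4 * (μ I.left * μ I.right) / μ I ^ 2) := by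
    rw [fluct, energy, mul_pow, sq_abs]; field_simp; ring
  rw [this]
  exact mul_le_of_le_one_right h4 h3

/-- The Haar function is a combination of the indicator of the interval and the Haar function
adapted to `μ`: the first gives the average of `f` times the increment of `μ`, the second the
fluctuation. -/
theorem abs_diff_le (hμ : ∀ I, 0 < μ I) (hμadd : IsAdditive μ) (h : IsTest μ f F y)
    (I : DyadicInterval) : |diff f I| ≤ |diff μ I| * (F I / μ I) + fluct μ f I := by
  have h0 := hμ I; have h1 := hμ I.left; have h2 := hμ I.right
  have h3 : μ I.left + μ I.right ≠ 0 := by positivity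
  have e : diff f I = diff μ I * (f I / μ I) +
      2 * (μ I.left * μ I.right) / μ I * (f I.left / μ I.left - f I.right / μ I.right) := by
    rw [diff, diff, h.add I, hμadd I]; field_simp; ring
  rw [e]
  refine (abs_add_le _ _).trans (add_le_add ?_ ?_)
  · rw [abs_mul, abs_div, abs_of_pos h0]
    exact mul_le_mul_of_nonneg_left (div_le_div_of_nonneg_right (h.abs_le I) h0.le) (abs_nonneg _)
  · rw [abs_mul, fluct, abs_of_nonneg (by positivity)]

/-- Bessel's inequality on a tree. -/
theorem treeSum_diff_sq_div_len_le (h : IsTest len f F y) (n : ℕ) (I : DyadicInterval) :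
    treeSum (fun J => diff f J ^ 2 / J.len) n I ≤ y I := by
  refine (treeSum_mono (fun J => ?_) n I).trans (treeSum_energy_le len_pos isAdditive_len h n I)
  have := J.len_pos
  rw [energy, len_left, len_right, diff]
  apply le_of_eq
  field_simp

end Energy

/-! ### Tree estimates for the shift form and the paraproduct coefficients -/

section Main

variable {Q : ℝ} {σ w f F g G y z v u p P : DyadicInterval → ℝ}

theorem IsA2Pair.treeSum_diff_mul_avg_le (h : IsA2Pair Q σ w) (hF : IsSqDominated σ F y) (n : ℕ)
    (I : DyadicInterval) :
    treeSum (fun J => (|diff σ J| * (F J / σ J)) ^ 2 / σ J) n I ≤ 128 * Q * y I := by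
  have hQ := h.one_le
  have := treeSum_carleson_le (a := fun J => diff σ J ^ 2 / σ J) (by positivity) h.pos_left
    h.add_left hF (fun J => div_nonneg (sq_nonneg _) (h.pos_left J).le) h.treeSum_diff_sq_div_le n I
  refine le_trans (treeSum_mono (fun J => le_of_eq ?_) n I) (this.trans_eq (by ring))
  rw [mul_pow, sq_abs]; ring

/-- The lower square function estimate, in dual form. -/
theorem IsA2Pair.treeSum_diff_sq_div_weight_le (h : IsA2Pair Q σ w) (hf : IsTest σ f F y) (n : ℕ)
    (I : DyadicInterval) :
    treeSum (fun J => diff f J ^ 2 / σ J) n I ≤ 258 * Q * y I := by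
  have hQ := h.one_le
  have hy := hf.nonneg_right h.pos_left I
  have h1 := h.treeSum_diff_mul_avg_le hf.toIsSqDominated n I
  have h2 := treeSum_energy_le h.pos_left h.add_left hf n I
  have h3 : treeSum (fun J => diff f J ^ 2 / σ J) n I ≤
      treeSum (fun J => 2 * ((|diff σ J| * (F J / σ J)) ^ 2 / σ J) + 2 * energy σ f J) n I := by
    refine treeSum_mono (fun J => ?_) n I
    have hs := h.pos_left J
    have h4 := fluct_sq_div_le (f := f) h.pos_left h.add_left J
    have h5 := abs_diff_le h.pos_left h.add_left hf J
    have h6 : diff f J ^ 2 ≤ 2 * (|diff σ J| * (F J / σ J)) ^ 2 + 2 * fluct σ f J ^ 2 := by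
      rw [← sq_abs (diff f J)]
      nlinarith [pow_le_pow_left₀ (abs_nonneg _) h5 2,
        sq_nonneg (|diff σ J| * (F J / σ J) - fluct σ f J)]
    have h7 := div_le_div_of_nonneg_right h6 hs.le
    rw [add_div, mul_div_assoc, mul_div_assoc] at h7
    linarith
  rw [treeSum_add, treeSum_const_mul, treeSum_const_mul] at h3
  nlinarith

/-- If most of the mass lies in the right half, the mass is controlled by the difference. -/
theorem sq_le_of_left_small (h : IsA2Pair Q σ w) {J : DyadicInterval} (hJ : 8 * σ J.left < σ J) :
    σ J ^ 2 ≤ 2 * diff σ J ^ 2 := by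
  have h0 := h.pos_left J.left
  have h1 : diff σ J = 2 * σ J.left - σ J := by rw [diff, h.add_left J]; ring
  rw [h1]
  nlinarith

/-- The Carleson condition for the shift, whose two factors live on different generations. If `σ J`
is comparable to `σ J.left`, the arithmetic-geometric inequality reduces to the one-weight sequences
on `J` and on `J.left`. Otherwise the right half carries most of `σ J`, so `σ J` is controlled by
`|diff σ J|` and the trivial bound for the increment of `w` suffices. -/
theorem IsA2Pair.treeSum_shift_le (h : IsA2Pair Q σ w) (n : ℕ) (I : DyadicInterval) :
    treeSum (fun J => |diff σ J| * |diff w J.left| / J.len) n I ≤ 96 * Q * I.len := by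
  have hB := h.treeSum_diff_sq_mul_le n I
  have hB' := h.symm.treeSum_diff_sq_mul_le (n + 1) I
  have hB0 : ∀ J, 0 ≤ diff w J ^ 2 * σ J / (w J * J.len) := fun J => by
    have := h.pos_left J; have := h.pos_right J; have := J.len_pos; positivity
  have hB'' := (treeSum_comp_left_le hB0 n I).trans hB'
  have key : treeSum (fun J => |diff σ J| * |diff w J.left| / J.len) n I ≤
      treeSum (fun J => 2 * (diff σ J ^ 2 * w J / (σ J * J.len)) +
        4 * (diff w J.left ^ 2 * σ J.left / (w J.left * J.left.len))) n I := by
    refine treeSum_mono (fun J => ?_) n I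
    have hl := J.len_pos
    have hs := h.pos_left J
    have hw := h.pos_right J
    have hs1 := h.pos_left J.left
    have hw1 := h.pos_right J.left
    have hwle : w J.left ≤ w J := by rw [h.add_right J]; linarith [h.pos_right J.right]
    have hd := (abs_diff_lt h.pos_left h.add_left J).le
    have hd' := (abs_diff_lt h.pos_right h.add_right J.left).le
    rcases le_or_gt (σ J) (8 * σ J.left) with hc | hc
    · have h1 : |diff σ J| * |diff w J.left| ≤
          diff σ J ^ 2 * w J / σ J / 2 + diff w J.left ^ 2 * σ J / w J.left / 2 := by
        rw [← sq_abs (diff σ J), ← sq_abs (diff w J.left)]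
        set a := |diff σ J|
        set b := |diff w J.left|
        have h2 : a ^ 2 * w J.left / σ J ≤ a ^ 2 * w J / σ J := by gcongr
        have h3 : 2 * (a * b) ≤ a ^ 2 * w J.left / σ J + b ^ 2 * σ J / w J.left := by
          rw [div_add_div _ _ hs.ne' hw1.ne', le_div_iff₀ (by positivity)]
          nlinarith [sq_nonneg (a * w J.left - b * σ J)]
        linarith
      have h2 : diff w J.left ^ 2 * σ J / w J.left ≤
          diff w J.left ^ 2 * (8 * σ J.left) / w J.left := by gcongr
      have h3 : |diff σ J| * |diff w J.left| ≤
          diff σ J ^ 2 * w J / σ J / 2 + diff w J.left ^ 2 * (8 * σ J.left) / w J.left / 2 := by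
        linarith
      have h4 := div_le_div_of_nonneg_right h3 hl.le
      have e : (diff σ J ^ 2 * w J / σ J / 2 +
          diff w J.left ^ 2 * (8 * σ J.left) / w J.left / 2) / J.len =
          (diff σ J ^ 2 * w J / (σ J * J.len)) / 2 +
          2 * (diff w J.left ^ 2 * σ J.left / (w J.left * J.left.len)) := by
        rw [len_left]; field_simp; ring
      have e0 : 0 ≤ diff σ J ^ 2 * w J / (σ J * J.len) := by positivity
      have e1 := hB0 J.left
      linarith
    · have h1 := sq_le_of_left_small h hc
      have h2 : |diff σ J| * |diff w J.left| / J.len ≤ σ J * w J / J.len := by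
        gcongr; exact hd'.trans hwle
      have h3 : σ J * w J / J.len ≤ 2 * (diff σ J ^ 2 * w J / (σ J * J.len)) := by
        rw [show σ J * w J / J.len = σ J ^ 2 * (w J / (σ J * J.len)) by field_simp]
        have := mul_le_mul_of_nonneg_right h1 (by positivity : 0 ≤ w J / (σ J * J.len))
        calc _ ≤ _ := this
          _ = _ := by ring
      have e1 := hB0 J.left
      linarith
  rw [treeSum_add, treeSum_const_mul, treeSum_const_mul] at key
  linarith

/-- The bilinear form of the Haar shift is bounded linearly in the `A₂` characteristic. -/
theorem IsA2Pair.treeSum_shift_form_le (h : IsA2Pair Q σ w) (hf : IsTest σ f F y)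
    (hg : IsTest w g G z) (n : ℕ) (I : DyadicInterval) :
    treeSum (fun J => |diff f J| * |diff g J.left| / J.len) n I ≤ 449 * Q * (y I + z I) := by
  have hQ := h.one_le
  have hF0 : ∀ J, 0 ≤ F J / σ J := fun J => div_nonneg (hf.nonneg J) (h.pos_left J).le
  have hG0 : ∀ J, 0 ≤ G J / w J := fun J => div_nonneg (hg.nonneg J) (h.pos_right J).le
  have ha0 : ∀ J : DyadicInterval, 0 ≤ |diff σ J| * |diff w J.left| / J.len := fun J => by
    have := J.len_pos; positivity
  have t4 := treeSum_bilinear_le (M := fun J => F J / σ J)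
    (N := fun J => G J.left / w J.left) (A := 192 * Q) (ρ := len)
    (a := fun J => |diff σ J| * |diff w J.left| / J.len)
    (θ := fun J => |diff σ J| * |diff w J.left| / J.len * (F J / σ J * (G J.left / w J.left)))
    (by positivity)
    h.pos_left h.pos_right isAdditive_len h.add_left h.add_right
    h.sq_len_le hf.toIsSqDominated hg.toIsSqDominated ha0
    (fun n I => (h.treeSum_shift_le n I).trans (by nlinarith [len_pos I]))
    (fun J => hG0 _) (fun J => le_rfl)
    (fun J => Or.inr ⟨fun n => (by
      have h1 := h.treeSum_shift_le (n + 1) J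
      have h2 := treeSum_nonneg ha0 n J.right
      rw [treeSum] at h1
      rw [len_left]
      linarith), le_max_left _ _, le_max_right _ _⟩) n I
  have t1 := treeSum_energy_le h.pos_left h.add_left hf n I
  have t2 := (treeSum_comp_left_le (energy_nonneg (f := g) h.pos_right) n I).trans
    (treeSum_energy_le h.pos_right h.add_right hg (n + 1) I)
  have t3 := h.treeSum_diff_mul_avg_le hf.toIsSqDominated n I
  have t5 := (treeSum_comp_left_le (θ := fun J => (|diff w J| * (G J / w J)) ^ 2 / w J)
    (fun J => div_nonneg (sq_nonneg _) (h.pos_right J).le) n I).trans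
    (h.symm.treeSum_diff_mul_avg_le hg.toIsSqDominated (n + 1) I)
  have key : treeSum (fun J => |diff f J| * |diff g J.left| / J.len) n I ≤
      treeSum (fun J => |diff σ J| * |diff w J.left| / J.len * (F J / σ J * (G J.left / w J.left)) +
        (1 / 2 * ((|diff σ J| * (F J / σ J)) ^ 2 / σ J) +
        (1 / 2 * ((|diff w J.left| * (G J.left / w J.left)) ^ 2 / w J.left) +
        (Q * energy σ f J + Q * energy w g J.left)))) n I := by
    refine treeSum_mono (fun J => ?_) n I
    have hl := J.len_pos
    have hs := h.pos_left J
    have hw := h.pos_right J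
    have hw1 := h.pos_right J.left
    have hwle : w J.left ≤ w J := by rw [h.add_right J]; linarith [h.pos_right J.right]
    have d1 := abs_diff_le h.pos_left h.add_left hf J
    have d2 := abs_diff_le h.pos_right h.add_right hg J.left
    have e1 := fluct_sq_div_le (f := f) h.pos_left h.add_left J
    have e2 := fluct_sq_div_le (f := g) h.pos_right h.add_right J.left
    have hY0 := fluct_nonneg (f := f) h.pos_left J
    have hY1 := fluct_nonneg (f := g) h.pos_right J.left
    have hX0 : 0 ≤ |diff σ J| * (F J / σ J) := mul_nonneg (abs_nonneg _) (hF0 J)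
    have hX1 : 0 ≤ |diff w J.left| * (G J.left / w J.left) := mul_nonneg (abs_nonneg _) (hG0 _)
    have hT : |diff σ J| * |diff w J.left| / J.len * (F J / σ J * (G J.left / w J.left)) =
        (|diff σ J| * (F J / σ J)) * (|diff w J.left| * (G J.left / w J.left)) / J.len := by ring
    rw [hT]
    set X := |diff σ J| * (F J / σ J)
    set X' := |diff w J.left| * (G J.left / w J.left)
    set Y := fluct σ f J
    set Y' := fluct w g J.left
    have hprod : |diff f J| * |diff g J.left| ≤ (X + Y) * (X' + Y') :=
      mul_le_mul d1 d2 (abs_nonneg _) (by positivity)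
    have hσw : σ J * w J.left ≤ Q * J.len ^ 2 :=
      (mul_le_mul_of_nonneg_left hwle hs.le).trans (h.le_sq_len J)
    -- The `A₂` factor `Q` may be placed on either factor, and it goes on a fluctuation: those sums
    -- are bounded by the energy without `Q`, whereas the average parts already cost `Q`.
    have amgm : ∀ {a b : ℝ}, 0 ≤ a → 0 ≤ b →
        a * b / J.len ≤ 1 / 2 * (Q * (a ^ 2 / σ J)) + 1 / 2 * (b ^ 2 / w J.left) := by
      intro a b ha hb
      have h1 : a * b / J.len * (a * b / J.len) ≤ (Q * (a ^ 2 / σ J)) * (b ^ 2 / w J.left) := by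
        have : 1 / J.len ^ 2 ≤ Q / (σ J * w J.left) := by
          rw [div_le_div_iff₀ (by positivity) (by positivity)]; linarith
        have := mul_le_mul_of_nonneg_left this (by positivity : 0 ≤ a ^ 2 * b ^ 2)
        calc _ = a ^ 2 * b ^ 2 * (1 / J.len ^ 2) := by field_simp
          _ ≤ _ := this
          _ = _ := by field_simp
      apply le_of_sq_le_sq _ (by positivity)
      nlinarith [sq_nonneg (Q * (a ^ 2 / σ J) - b ^ 2 / w J.left)]
    have amgm' : ∀ {a b : ℝ}, 0 ≤ a → 0 ≤ b →
        a * b / J.len ≤ 1 / 2 * (a ^ 2 / σ J) + 1 / 2 * (Q * (b ^ 2 / w J.left)) := by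
      intro a b ha hb
      have h1 : a * b / J.len * (a * b / J.len) ≤ (a ^ 2 / σ J) * (Q * (b ^ 2 / w J.left)) := by
        have : 1 / J.len ^ 2 ≤ Q / (σ J * w J.left) := by
          rw [div_le_div_iff₀ (by positivity) (by positivity)]; linarith
        have := mul_le_mul_of_nonneg_left this (by positivity : 0 ≤ a ^ 2 * b ^ 2)
        calc _ = a ^ 2 * b ^ 2 * (1 / J.len ^ 2) := by field_simp
          _ ≤ _ := this
          _ = _ := by field_simp
      apply le_of_sq_le_sq _ (by positivity)
      nlinarith [sq_nonneg (a ^ 2 / σ J - Q * (b ^ 2 / w J.left))]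
    have b1 := amgm hY0 hX1
    have b2 := amgm' hX0 hY1
    have b3 := amgm hY0 hY1
    have hdiv := div_le_div_of_nonneg_right hprod hl.le
    have hexp : (X + Y) * (X' + Y') / J.len =
        X * X' / J.len + X * Y' / J.len + Y * X' / J.len + Y * Y' / J.len := by ring
    have e1' := mul_le_mul_of_nonneg_left e1 (by linarith : 0 ≤ Q)
    have e2' := mul_le_mul_of_nonneg_left e2 (by linarith : 0 ≤ Q)
    have e3 : Y' ^ 2 / w J.left ≤ Q * (Y' ^ 2 / w J.left) :=
      le_mul_of_one_le_left (by positivity) hQ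
    linarith
  rw [treeSum_add, treeSum_add, treeSum_add, treeSum_add, treeSum_const_mul, treeSum_const_mul,
    treeSum_const_mul, treeSum_const_mul] at key
  have t1' := mul_le_mul_of_nonneg_left t1 (by linarith : 0 ≤ Q)
  have t2' := mul_le_mul_of_nonneg_left t2 (by linarith : 0 ≤ Q)
  linarith

/-- The Haar coefficient, times `√|J|`, of the image of `φ` under the inner paraproduct. Here
`f`, `p`, `v` are the integrals of `ω^{-1/2} φ`, `φ` and `ω^{-1/2}`. -/
def innerCoeff (f p v : DyadicInterval → ℝ) (J : DyadicInterval) : ℝ :=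
  diff f J - v J / J.len * diff p J - p J / J.len * diff v J

/-- This controls the last term of `innerCoeff`, where a mean of `φ` meets a Haar coefficient of
`ω^{-1/2}`: Carleson embedding for Lebesgue measure. -/
theorem IsA2Pair.treeSum_mean_le (h : IsA2Pair Q σ w) (hp : IsTest len p P y)
    (hv : ∀ I, 0 < v I) (hadd : IsAdditive v) (hvσ : ∀ I, v I ^ 2 ≤ σ I * I.len) (n : ℕ)
    (I : DyadicInterval) :
    treeSum (fun J => diff v J ^ 2 * w J / J.len ^ 2 * (p J / J.len) ^ 2) n I ≤ 64 * Q * y I := by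
  have hQ := h.one_le
  have key := treeSum_carleson_le (a := fun J => diff v J ^ 2 * w J / J.len ^ 2) (A := 16 * Q)
    (by positivity) len_pos isAdditive_len hp.toIsSqDominated
    (fun J => by have := h.pos_right J; positivity)
    (h.treeSum_diff_sqrt_sq_mul_le hv hadd hvσ) n I
  refine (treeSum_mono (fun J => ?_) n I).trans (key.trans_eq (by ring))
  have := h.pos_right J
  have := J.len_pos
  apply mul_le_mul_of_nonneg_left _ (by positivity)
  rw [div_pow, div_pow]
  exact div_le_div_of_nonneg_right (sq_le_sq.2 ((hp.abs_le J).trans (le_abs_self _)))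
    (by positivity)

/-- Of the three parts of `innerCoeff`, the first is the weighted square estimate, the second
reduces to Bessel by `v² ≤ σ |J|`, and the third to `treeSum_mean_le` by `1/σ ≤ w / |J|²`. The
constant is `3 (258 + 1 + 64)`. -/
theorem IsA2Pair.treeSum_innerCoeff_sq_le (h : IsA2Pair Q σ w) (hf : IsTest σ f F y)
    (hp : IsTest len p P y) (hv : ∀ I, 0 < v I) (hadd : IsAdditive v)
    (hvσ : ∀ I, v I ^ 2 ≤ σ I * I.len) (n : ℕ) (I : DyadicInterval) :
    treeSum (fun J => innerCoeff f p v J ^ 2 / σ J) n I ≤ 969 * Q * y I := by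
  have hQ := h.one_le
  have hy := hf.nonneg_right h.pos_left I
  have t1 := h.treeSum_diff_sq_div_weight_le hf n I
  have t2 := treeSum_diff_sq_div_len_le hp n I
  have t3 := h.treeSum_mean_le hp hv hadd hvσ n I
  have key : treeSum (fun J => innerCoeff f p v J ^ 2 / σ J) n I ≤
      treeSum (fun J => 3 * (diff f J ^ 2 / σ J) + (3 * (diff p J ^ 2 / J.len) +
        3 * (diff v J ^ 2 * w J / J.len ^ 2 * (p J / J.len) ^ 2))) n I := by
    refine treeSum_mono (fun J => ?_) n I
    have hl := J.len_pos
    have hs := h.pos_left J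
    have hw := h.pos_right J
    have h1 : innerCoeff f p v J ^ 2 ≤ 3 * diff f J ^ 2 + 3 * (v J / J.len * diff p J) ^ 2 +
        3 * (p J / J.len * diff v J) ^ 2 := by
      rw [innerCoeff]
      nlinarith [sq_nonneg (diff f J + v J / J.len * diff p J),
        sq_nonneg (diff f J + p J / J.len * diff v J),
        sq_nonneg (v J / J.len * diff p J - p J / J.len * diff v J)]
    have h2 := div_le_div_of_nonneg_right h1 hs.le
    have h3 : (v J / J.len * diff p J) ^ 2 / σ J ≤ diff p J ^ 2 / J.len := by
      rw [mul_pow, div_pow, div_le_div_iff₀ hs hl]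
      have := mul_le_mul_of_nonneg_right (hvσ J) (sq_nonneg (diff p J))
      have h5 : v J ^ 2 / J.len ^ 2 * diff p J ^ 2 * J.len = v J ^ 2 * diff p J ^ 2 / J.len := by
        field_simp
      rw [h5, div_le_iff₀ hl]
      linarith
    have h4 : (p J / J.len * diff v J) ^ 2 / σ J ≤
        diff v J ^ 2 * w J / J.len ^ 2 * (p J / J.len) ^ 2 := by
      rw [div_le_iff₀ hs, mul_pow]
      have : (1 : ℝ) ≤ σ J * w J / J.len ^ 2 := by
        rw [one_le_div (by positivity)]; exact h.sq_len_le J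
      have := mul_le_mul_of_nonneg_left this
        (by positivity : 0 ≤ (p J / J.len) ^ 2 * diff v J ^ 2)
      calc _ = (p J / J.len) ^ 2 * diff v J ^ 2 * 1 := by ring
        _ ≤ _ := this
        _ = _ := by ring
    have e : (3 * diff f J ^ 2 + 3 * (v J / J.len * diff p J) ^ 2 +
        3 * (p J / J.len * diff v J) ^ 2) / σ J = 3 * (diff f J ^ 2 / σ J) +
        3 * ((v J / J.len * diff p J) ^ 2 / σ J) + 3 * ((p J / J.len * diff v J) ^ 2 / σ J) := by
      ring
    linarith
  rw [treeSum_add, treeSum_add, treeSum_const_mul, treeSum_const_mul, treeSum_const_mul] at key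
  nlinarith

/-- The part with `diff f` is the shift form. The two corrections are paired with `g` by
Cauchy-Schwarz, weighted by `w`, so that both resulting square sums cost one factor `Q`. -/
theorem IsA2Pair.treeSum_innerCoeff_mul_le (h : IsA2Pair Q σ w) (hf : IsTest σ f F y)
    (hp : IsTest len p P y) (hg : IsTest w g G z) (hv : ∀ I, 0 < v I) (hadd : IsAdditive v)
    (hvσ : ∀ I, v I ^ 2 ≤ σ I * I.len) (n : ℕ) (I : DyadicInterval) :
    treeSum (fun J => |innerCoeff f p v J| * |diff g J.left| / J.len) n I ≤
      600 * Q * (y I + z I) := by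
  have hQ := h.one_le
  have hy := hf.nonneg_right h.pos_left I
  have hz := hg.nonneg_right h.pos_right I
  have t1 := h.treeSum_shift_form_le hf hg n I
  have t2 := treeSum_diff_sq_div_len_le hp n I
  have t3 := h.treeSum_mean_le hp hv hadd hvσ n I
  have t4 := (treeSum_comp_left_le (θ := fun J => diff g J ^ 2 / w J)
    (fun J => div_nonneg (sq_nonneg _) (h.pos_right J).le) n I).trans
    (h.symm.treeSum_diff_sq_div_weight_le hg (n + 1) I)
  have key : treeSum (fun J => |innerCoeff f p v J| * |diff g J.left| / J.len) n I ≤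
      treeSum (fun J => |diff f J| * |diff g J.left| / J.len + (Q * (diff p J ^ 2 / J.len) +
        (1 * (diff v J ^ 2 * w J / J.len ^ 2 * (p J / J.len) ^ 2) +
          (1 / 2) * (diff g J.left ^ 2 / w J.left)))) n I := by
    refine treeSum_mono (fun J => ?_) n I
    have hl := J.len_pos
    have hs := h.pos_left J
    have hw := h.pos_right J
    have hw1 := h.pos_right J.left
    have hwle : w J.left ≤ w J := by rw [h.add_right J]; linarith [h.pos_right J.right]
    set D := v J / J.len * diff p J + p J / J.len * diff v J with hD
    have h1 : |innerCoeff f p v J| ≤ |diff f J| + |D| := by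
      have : innerCoeff f p v J = diff f J - D := by rw [innerCoeff, hD]; ring
      rw [this]; exact abs_sub _ _
    have h2 : |D| * |diff g J.left| / J.len ≤
        1 / 2 * (D ^ 2 * w J / J.len ^ 2) + 1 / 2 * (diff g J.left ^ 2 / w J.left) := by
      have h3 : diff g J.left ^ 2 / w J ≤ diff g J.left ^ 2 / w J.left := by gcongr
      have h4 : |D| * |diff g J.left| / J.len ≤
          1 / 2 * (D ^ 2 * w J / J.len ^ 2) + 1 / 2 * (diff g J.left ^ 2 / w J) := by
        rw [← sq_abs D, ← sq_abs (diff g J.left)]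
        set a := |D|
        set b := |diff g J.left|
        have : 0 ≤ (a * w J / J.len - b) ^ 2 / w J := by positivity
        have e : (a * w J / J.len - b) ^ 2 / w J =
          a ^ 2 * w J / J.len ^ 2 - 2 * (a * b / J.len) + b ^ 2 / w J := by
            field_simp
            ring
        linarith
      linarith
    have h5 : D ^ 2 * w J / J.len ^ 2 ≤ 2 * (Q * (diff p J ^ 2 / J.len)) +
        2 * (diff v J ^ 2 * w J / J.len ^ 2 * (p J / J.len) ^ 2) := by
      have h6 : D ^ 2 ≤ 2 * (v J / J.len * diff p J) ^ 2 + 2 * (p J / J.len * diff v J) ^ 2 := by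
        rw [hD]; nlinarith [sq_nonneg (v J / J.len * diff p J - p J / J.len * diff v J)]
      have h7 := mul_le_mul_of_nonneg_right h6 (by positivity : 0 ≤ w J / J.len ^ 2)
      have h8 : v J ^ 2 * w J ≤ Q * J.len ^ 3 := by
        have i1 := mul_le_mul_of_nonneg_right (hvσ J) hw.le
        have i2 := mul_le_mul_of_nonneg_right (h.le_sq_len J) hl.le
        nlinarith
      have h9 : (v J / J.len * diff p J) ^ 2 * (w J / J.len ^ 2) ≤ Q * (diff p J ^ 2 / J.len) := by
        have := mul_le_mul_of_nonneg_right h8 (by positivity : 0 ≤ diff p J ^ 2 / J.len ^ 4)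
        calc _ = v J ^ 2 * w J * (diff p J ^ 2 / J.len ^ 4) := by field_simp
          _ ≤ _ := this
          _ = _ := by field_simp
      have e1 : D ^ 2 * w J / J.len ^ 2 = D ^ 2 * (w J / J.len ^ 2) := by ring
      have e2 : diff v J ^ 2 * w J / J.len ^ 2 * (p J / J.len) ^ 2 =
        (p J / J.len * diff v J) ^ 2 * (w J / J.len ^ 2) := by ring
      rw [e1, e2]
      linarith
    have h10 := mul_le_mul_of_nonneg_right h1 (abs_nonneg (diff g J.left))
    have h11 := div_le_div_of_nonneg_right h10 hl.le
    rw [add_mul, add_div] at h11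
    linarith
  rw [treeSum_add, treeSum_add, treeSum_add, treeSum_const_mul, treeSum_const_mul,
    treeSum_const_mul] at key
  have := mul_le_mul_of_nonneg_left t2 (by linarith : 0 ≤ Q)
  nlinarith

/-- Needed for the outer paraproduct. The sequence mixes `σ` on `J` with `u` on `J.left`; it is
Carleson by the same dichotomy as in `treeSum_shift_le`, and embedding over left children gives `8 *
96`. -/
theorem IsA2Pair.treeSum_outer_le (h : IsA2Pair Q σ w) (hp : IsTest len p P y)
    (hu : ∀ I, 0 < u I) (hadd : IsAdditive u) (huw : ∀ I, u I ^ 2 ≤ w I * I.len) (n : ℕ)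
    (I : DyadicInterval) :
    treeSum (fun J => diff u J.left ^ 2 * σ J / (J.left.len * J.len) *
      (p J.left / J.left.len) ^ 2) n I ≤ 768 * Q * y I := by
  have hQ := h.one_le
  have ha0 : ∀ J : DyadicInterval, 0 ≤ diff u J.left ^ 2 * σ J / (J.left.len * J.len) := fun J => by
    have := h.pos_left J; have := J.len_pos; have := J.left.len_pos; positivity
  have hc : ∀ n I, treeSum (fun J => diff u J.left ^ 2 * σ J / (J.left.len * J.len)) n I ≤
      96 * Q * I.len := by
    intro n I
    have hB := h.treeSum_diff_sq_mul_le n I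
    have hC := (treeSum_comp_left_le (θ := fun J => diff u J ^ 2 * σ J / J.len ^ 2)
      (fun J => by have := h.pos_left J; positivity) n I).trans
      (h.symm.treeSum_diff_sqrt_sq_mul_le hu hadd huw (n + 1) I)
    have key : treeSum (fun J => diff u J.left ^ 2 * σ J / (J.left.len * J.len)) n I ≤
        treeSum (fun J => 2 * (diff σ J ^ 2 * w J / (σ J * J.len)) +
          4 * (diff u J.left ^ 2 * σ J.left / J.left.len ^ 2)) n I := by
      refine treeSum_mono (fun J => ?_) n I
      have hl := J.len_pos
      have hs := h.pos_left J
      have hw := h.pos_right J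
      have hs1 := h.pos_left J.left
      have hwle : w J.left ≤ w J := by rw [h.add_right J]; linarith [h.pos_right J.right]
      have e0 : 0 ≤ diff σ J ^ 2 * w J / (σ J * J.len) := by positivity
      have e1 : 0 ≤ diff u J.left ^ 2 * σ J.left / J.left.len ^ 2 := by positivity
      rcases le_or_gt (σ J) (8 * σ J.left) with hc | hc
      · have h1 : diff u J.left ^ 2 * σ J / (J.left.len * J.len) ≤
            diff u J.left ^ 2 * (8 * σ J.left) / (J.left.len * J.len) := by
          have := J.left.len_pos
          gcongr
        have h2 : diff u J.left ^ 2 * (8 * σ J.left) / (J.left.len * J.len) =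
            4 * (diff u J.left ^ 2 * σ J.left / J.left.len ^ 2) := by
          rw [len_left]; field_simp; ring
        linarith
      · have h1 := sq_le_of_left_small h hc
        have h2 : diff u J.left ^ 2 ≤ w J * J.left.len :=
          (diff_sq_le hu hadd J.left).trans ((huw _).trans
            (mul_le_mul_of_nonneg_right hwle J.left.len_pos.le))
        have h4 : diff u J.left ^ 2 * σ J / (J.left.len * J.len) ≤ σ J * w J / J.len := by
          have := J.left.len_pos
          rw [div_le_div_iff₀ (by positivity) hl]
          have := mul_le_mul_of_nonneg_right h2 (by positivity : 0 ≤ σ J * J.len)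
          linarith
        have h3 : σ J * w J / J.len ≤ 2 * (diff σ J ^ 2 * w J / (σ J * J.len)) := by
          rw [show σ J * w J / J.len = σ J ^ 2 * (w J / (σ J * J.len)) by field_simp]
          have := mul_le_mul_of_nonneg_right h1 (by positivity : 0 ≤ w J / (σ J * J.len))
          calc _ ≤ _ := this
            _ = _ := by ring
        linarith
    rw [treeSum_add, treeSum_const_mul, treeSum_const_mul] at key
    linarith
  have key := treeSum_carleson_left_le (by positivity) hp.toIsSqDominated ha0 hc n I
  refine (treeSum_mono (fun J => ?_) n I).trans (key.trans_eq (by ring))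
  apply mul_le_mul_of_nonneg_left _ (ha0 J)
  have := J.left.len_pos
  rw [div_pow, div_pow]
  exact div_le_div_of_nonneg_right (sq_le_sq.2 ((hp.abs_le _).trans (le_abs_self _)))
    (by positivity)

end Main

/-! ### From trees to finite families -/

/-- `J` is one of the intervals of the first `n` generations below `I`. -/
def InTree : ℕ → DyadicInterval → DyadicInterval → Prop
  | 0, _, _ => False
  | n + 1, I, J => J = I ∨ InTree n I.left J ∨ InTree n I.right J

theorem InTree.succ {n : ℕ} {I J : DyadicInterval} (h : InTree n I J) : InTree (n + 1) I J := by
  induction n generalizing I with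
  | zero => exact h.elim
  | succ n ih =>
    rcases h with h | h | h
    · exact Or.inl h
    · exact Or.inr (Or.inl (ih h))
    · exact Or.inr (Or.inr (ih h))

theorem InTree.mono {n m : ℕ} (hnm : n ≤ m) {I J : DyadicInterval} (h : InTree n I J) :
    InTree m I J := by
  induction hnm with
  | refl => exact h
  | step _ ih => exact ih.succ

open Classical in
theorem sum_le_treeSum {θ : DyadicInterval → ℝ} (h0 : ∀ I, 0 ≤ θ I) (n : ℕ) (I : DyadicInterval)
    (s : Finset DyadicInterval) (hs : ∀ J ∈ s, InTree n I J) : ∑ J ∈ s, θ J ≤ treeSum θ n I := by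
  induction n generalizing I s with
  | zero =>
    have : s = ∅ := Finset.eq_empty_of_forall_notMem fun J hJ => hs J hJ
    simp [this, treeSum]
  | succ n ih =>
    have h1 := ih I.left (s.filter (InTree n I.left)) fun J hJ => (Finset.mem_filter.1 hJ).2
    have h2 := ih I.right (s.filter (InTree n I.right)) fun J hJ => (Finset.mem_filter.1 hJ).2
    have h3 : s ⊆ {I} ∪ (s.filter (InTree n I.left) ∪ s.filter (InTree n I.right)) := by
      intro J hJ
      have := hs J hJ
      simp only [Finset.mem_union, Finset.mem_singleton, Finset.mem_filter, hJ, true_and]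
      exact this
    have h4 := Finset.sum_le_sum_of_subset_of_nonneg h3 fun J _ _ => h0 J
    have h5 := Finset.sum_union_inter (s₁ := {I}) (f := θ)
      (s₂ := s.filter (InTree n I.left) ∪ s.filter (InTree n I.right))
    have h6 := Finset.sum_union_inter (f := θ)
      (s₁ := s.filter (InTree n I.left)) (s₂ := s.filter (InTree n I.right))
    have h7 := Finset.sum_nonneg fun J (_ : J ∈ {I} ∩ (s.filter (InTree n I.left) ∪
      s.filter (InTree n I.right))) => h0 J
    have h8 := Finset.sum_nonneg fun J (_ : J ∈ s.filter (InTree n I.left) ∩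
      s.filter (InTree n I.right)) => h0 J
    rw [Finset.sum_singleton] at h5
    rw [treeSum]
    linarith

/-- Every dyadic interval is eventually below one of the two intervals `[0, 2 ^ N)`,
`[-2 ^ N, 0)`. -/
theorem eventually_inTree (J : DyadicInterval) : ∃ N₀ : ℕ, ∀ N ≥ N₀,
    InTree (2 * N) ⟨-N, 0⟩ J ∨ InTree (2 * N) ⟨-N, -1⟩ J := by
  have up : ∀ (N m : ℕ), (InTree m ⟨-N, 0⟩ J ∨ InTree m ⟨-N, -1⟩ J) →
      (InTree (m + 1) ⟨-(N + 1 : ℕ), 0⟩ J ∨ InTree (m + 1) ⟨-(N + 1 : ℕ), -1⟩ J) := by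
    intro N m h
    have e1 : (⟨-(N + 1 : ℕ), 0⟩ : DyadicInterval).left = ⟨-N, 0⟩ := by
      ext <;> simp [left]
    have e2 : (⟨-(N + 1 : ℕ), -1⟩ : DyadicInterval).right = ⟨-N, -1⟩ := by
      ext <;> simp [right]
    rcases h with h | h
    · left; right; left; rw [e1]; exact h
    · right; right; right; rw [e2]; exact h
  -- Passing to the parent halves the index `k` with rounding down, so it reaches one of the fixed
  -- points 0 and -1.
  have anc : ∀ (t : ℕ) (k : ℤ) (n : ℤ) (m : ℕ), k.natAbs ≤ t → InTree m ⟨n, k⟩ J →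
      ∃ N₀ : ℕ, ∃ m', InTree m' ⟨n - N₀, 0⟩ J ∨ InTree m' ⟨n - N₀, -1⟩ J := by
    intro t
    induction t with
    | zero =>
      intro k n m hk h
      have : k = 0 := by omega
      subst this
      exact ⟨0, m, Or.inl (by simpa using h)⟩
    | succ t ih =>
      intro k n m hk h
      by_cases h0 : k = 0
      · subst h0; exact ⟨0, m, Or.inl (by simpa using h)⟩
      by_cases h1 : k = -1
      · subst h1; exact ⟨0, m, Or.inr (by simpa using h)⟩
      have h2 : InTree (m + 1) ⟨n - 1, k / 2⟩ J := by
        rcases Int.even_or_odd' k with ⟨j, hj | hj⟩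
        · right; left
          have : (⟨n - 1, k / 2⟩ : DyadicInterval).left = ⟨n, k⟩ := by
            ext <;> simp [left]
            omega
          rw [this]; exact h
        · right; right
          have : (⟨n - 1, k / 2⟩ : DyadicInterval).right = ⟨n, k⟩ := by
            ext <;> simp [right]
            omega
          rw [this]; exact h
      obtain ⟨N₀, m', h3⟩ := ih (k / 2) (n - 1) (m + 1) (by omega) h2
      refine ⟨N₀ + 1, m', ?_⟩
      have : n - ((N₀ + 1 : ℕ) : ℤ) = n - 1 - N₀ := by push_cast; ring
      rw [this]; exact h3
  obtain ⟨N₁, m, h⟩ := anc J.k.natAbs J.k J.n 1 le_rfl (Or.inl rfl)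
  have big : ∀ j : ℕ, (InTree (m + j) ⟨J.n - N₁ - j, 0⟩ J ∨ InTree (m + j) ⟨J.n - N₁ - j, -1⟩ J) := by
    intro j
    induction j with
    | zero => simpa using h
    | succ j ih =>
      have e1 : (⟨J.n - N₁ - (j + 1 : ℕ), 0⟩ : DyadicInterval).left = ⟨J.n - N₁ - j, 0⟩ := by
        ext <;> simp [left]; ring
      have e2 : (⟨J.n - N₁ - (j + 1 : ℕ), -1⟩ : DyadicInterval).right = ⟨J.n - N₁ - j, -1⟩ := by
        ext <;> simp [right]; ring
      rcases ih with h | h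
      · left; right; left; rw [e1]; exact h
      · right; right; right; rw [e2]; exact h
  -- A crude bound, large enough for the top interval at level `-N` to lie above the ancestor
  -- already found and for the depth `m + N - N₁ + J.n` to be at most `2 N`.
  refine ⟨(N₁ + (J.n.natAbs + m) - J.n).toNat + m + J.n.natAbs + m + m, fun N hN => ?_⟩
  have b2 := big (N - N₁ + J.n).toNat
  have e : J.n - N₁ - (N - N₁ + J.n).toNat = -(N : ℤ) := by omega
  rw [e] at b2
  have hle : m + (N - N₁ + J.n).toNat ≤ 2 * N := by omega
  exact b2.imp (InTree.mono hle) (InTree.mono hle)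

open Classical in
/-- A bound for all tree sums gives a bound for all finite sums. -/
theorem sum_le_of_treeSum_le {θ : DyadicInterval → ℝ} (h0 : ∀ I, 0 ≤ θ I) {X : ℝ}
    (h : ∀ n I, treeSum θ n I ≤ X) (s : Finset DyadicInterval) : ∑ J ∈ s, θ J ≤ 2 * X := by
  choose N₀ hN₀ using eventually_inTree
  set N := s.sup N₀ with hN
  have hs : ∀ J ∈ s, InTree (2 * N) ⟨-N, 0⟩ J ∨ InTree (2 * N) ⟨-N, -1⟩ J :=
    fun J hJ => hN₀ J N (Finset.le_sup hJ)
  have h1 := sum_le_treeSum h0 (2 * N) ⟨-N, 0⟩ (s.filter (InTree (2 * N) ⟨-N, 0⟩))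
    fun J hJ => (Finset.mem_filter.1 hJ).2
  have h2 := sum_le_treeSum h0 (2 * N) ⟨-N, -1⟩ (s.filter fun J => ¬ InTree (2 * N) ⟨-N, 0⟩ J)
    fun J hJ => (hs J (Finset.mem_filter.1 hJ).1).resolve_left (Finset.mem_filter.1 hJ).2
  -- The factor 2 counts the trees on the two half-lines.
  rw [← Finset.sum_filter_add_sum_filter_not s (InTree (2 * N) ⟨-N, 0⟩)]
  linarith [h (2 * N) ⟨-N, 0⟩, h (2 * N) ⟨-N, -1⟩]

/-! ### Geometry of the dyadic grid -/

theorem measurableSet_toSet (I : DyadicInterval) : MeasurableSet I.toSet := measurableSet_Ico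

theorem volume_toSet (I : DyadicInterval) : volume I.toSet = ENNReal.ofReal I.len := by
  rw [toSet, Real.volume_Ico]; congr 1; ring

theorem volume_toSet_lt_top (I : DyadicInterval) : volume I.toSet < ∞ := by
  rw [volume_toSet]; exact ENNReal.ofReal_lt_top

theorem mem_toSet_iff (I : DyadicInterval) (x : ℝ) : x ∈ I.toSet ↔ ⌊x / I.len⌋ = I.k := by
  have := I.len_pos
  rw [toSet, Set.mem_Ico, Int.floor_eq_iff, le_div_iff₀ this, div_lt_iff₀ this]

theorem toSet_left_eq (I : DyadicInterval) :
    I.left.toSet = Set.Ico (I.k * I.len) ((I.k + 1 / 2) * I.len) := by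
  rw [toSet, len_left]; simp only [left]; push_cast; congr 1 <;> ring

theorem toSet_right_eq (I : DyadicInterval) :
    I.right.toSet = Set.Ico ((I.k + 1 / 2) * I.len) ((I.k + 1) * I.len) := by
  rw [toSet, len_right]; simp only [right]; push_cast; congr 1 <;> ring

theorem left_union_right (I : DyadicInterval) : I.left.toSet ∪ I.right.toSet = I.toSet := by
  have := I.len_pos
  rw [toSet_left_eq, toSet_right_eq, toSet, Set.Ico_union_Ico_eq_Ico] <;> nlinarith

theorem left_subset (I : DyadicInterval) : I.left.toSet ⊆ I.toSet :=
  (left_union_right I).subset.trans' Set.subset_union_left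

theorem right_subset (I : DyadicInterval) : I.right.toSet ⊆ I.toSet :=
  (left_union_right I).subset.trans' Set.subset_union_right

theorem disjoint_of_level_eq {I J : DyadicInterval} (h : I.n = J.n) (hne : I ≠ J) :
    Disjoint I.toSet J.toSet := by
  rw [Set.disjoint_left]
  intro x hI hJ
  rw [mem_toSet_iff] at hI hJ
  have hl : I.len = J.len := by rw [len, len, h]
  rw [hl] at hI
  exact hne (DyadicInterval.ext h (hI.symm.trans hJ))

theorem disjoint_left_right (I : DyadicInterval) : Disjoint I.left.toSet I.right.toSet :=
  disjoint_of_level_eq rfl (by simp [left, right])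

/-- Each interval is a child of an interval one level up. -/
theorem exists_parent (J : DyadicInterval) : ∃ K : DyadicInterval, K.n = J.n - 1 ∧
    (J = K.left ∨ J = K.right) := by
  refine ⟨⟨J.n - 1, J.k / 2⟩, rfl, ?_⟩
  rcases Int.even_or_odd' J.k with ⟨j, hj | hj⟩
  · left; ext <;> simp [left]; omega
  · right; ext <;> simp [right]; omega

theorem exists_ancestor (J : DyadicInterval) (d : ℕ) : ∃ K : DyadicInterval,
    K.n = J.n - d ∧ J.toSet ⊆ K.toSet := by
  induction d with
  | zero => exact ⟨J, by simp, subset_rfl⟩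
  | succ d ih =>
    obtain ⟨K, hK, hJ⟩ := ih
    obtain ⟨L, hL, h⟩ := exists_parent K
    refine ⟨L, by rw [hL, hK]; push_cast; ring, hJ.trans ?_⟩
    rcases h with rfl | rfl
    · exact left_subset L
    · exact right_subset L

theorem nested_of_level_lt {I J : DyadicInterval} (h : I.n < J.n) :
    J.toSet ⊆ I.left.toSet ∨ J.toSet ⊆ I.right.toSet ∨ Disjoint I.toSet J.toSet := by
  obtain ⟨K, hK, hJ⟩ := exists_ancestor J (J.n - (I.n + 1)).toNat
  have hKn : K.n = I.n + 1 := by omega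
  by_cases hl : I.left = K
  · left; rw [hl]; exact hJ
  by_cases hr : I.right = K
  · right; left; rw [hr]; exact hJ
  · right; right
    rw [← left_union_right, Set.disjoint_union_left]
    exact ⟨(disjoint_of_level_eq hKn.symm hl).mono_right hJ,
      (disjoint_of_level_eq hKn.symm hr).mono_right hJ⟩

theorem left_injective : Function.Injective left := fun I J h => by
  simp only [left, DyadicInterval.mk.injEq] at h
  ext <;> omega

instance : Countable DyadicInterval :=
  (show Function.Injective fun I : DyadicInterval => (I.n, I.k) from fun I J h => by
    simp only [Prod.mk.injEq] at h; exact DyadicInterval.ext h.1 h.2).countable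

/-! ### Haar functions -/

/-- The integral of `u` over a dyadic interval. -/
def mass (u : ℝ → ℝ) (I : DyadicInterval) : ℝ := ∫ x in I.toSet, u x

/-- Integrability on all dyadic intervals. -/
def DyadicIntegrable (u : ℝ → ℝ) : Prop := ∀ I : DyadicInterval, IntegrableOn u I.toSet

theorem isAdditive_mass {u : ℝ → ℝ} (hu : DyadicIntegrable u) : IsAdditive (mass u) := fun I => by
  simp only [mass]
  rw [← left_union_right I, setIntegral_union (disjoint_left_right I) (measurableSet_toSet _)
    (hu _) (hu _)]

theorem pairing_h_one (u : ℝ → ℝ) (I : DyadicInterval) : pairing u (h 1 I) = mass u I / I.len := by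
  have : (fun x => u x * h 1 I x) = fun x => I.len⁻¹ * I.toSet.indicator u x := by
    funext x
    by_cases hx : x ∈ I.toSet <;> simp [h, hx]
    ring
  rw [pairing, this, integral_const_mul, integral_indicator (measurableSet_toSet I), mass]
  ring

theorem mul_h_zero (u : ℝ → ℝ) (I : DyadicInterval) : (fun x => u x * h 0 I x) = fun x =>
    (√I.len)⁻¹ * (I.left.toSet.indicator u x - I.right.toSet.indicator u x) := by
  funext x
  by_cases hx : x ∈ I.left.toSet <;> by_cases hy : x ∈ I.right.toSet <;> simp [h, hx, hy]
  all_goals ring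

theorem integrable_mul_h_zero {u : ℝ → ℝ} (hu : DyadicIntegrable u) (I : DyadicInterval) :
    Integrable fun x => u x * h 0 I x := by
  rw [mul_h_zero]
  exact (((integrable_indicator_iff (measurableSet_toSet _)).2 (hu _)).sub
    ((integrable_indicator_iff (measurableSet_toSet _)).2 (hu _))).const_mul _

theorem pairing_h_zero {u : ℝ → ℝ} (hu : DyadicIntegrable u) (I : DyadicInterval) :
    pairing u (h 0 I) = (√I.len)⁻¹ * diff (mass u) I := by
  rw [pairing, mul_h_zero, integral_const_mul, integral_sub
    ((integrable_indicator_iff (measurableSet_toSet _)).2 (hu _))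
    ((integrable_indicator_iff (measurableSet_toSet _)).2 (hu _)),
    integral_indicator (measurableSet_toSet _), integral_indicator (measurableSet_toSet _)]
  rfl

theorem dyadicIntegrable_const (c : ℝ) : DyadicIntegrable fun _ => c := fun I =>
  integrableOn_const (volume_toSet_lt_top I).ne

theorem mass_const (c : ℝ) (I : DyadicInterval) : mass (fun _ => c) I = I.len * c := by
  rw [mass, setIntegral_const, measureReal_def, volume_toSet, ENNReal.toReal_ofReal I.len_pos.le,
    smul_eq_mul]

theorem h_zero_of_notMem {I : DyadicInterval} {x : ℝ} (hx : x ∉ I.toSet) : h 0 I x = 0 := by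
  have h1 : x ∉ I.left.toSet := fun h => hx (left_subset I h)
  have h2 : x ∉ I.right.toSet := fun h => hx (right_subset I h)
  simp [h, h1, h2]

theorem h_one_of_notMem {I : DyadicInterval} {x : ℝ} (hx : x ∉ I.toSet) : h 1 I x = 0 := by
  simp [h, hx]

theorem h_zero_of_mem_left {I : DyadicInterval} {x : ℝ} (hx : x ∈ I.left.toSet) :
    h 0 I x = (√I.len)⁻¹ := by
  simp [h, hx, Set.disjoint_left.1 (disjoint_left_right I) hx]

theorem h_zero_of_mem_right {I : DyadicInterval} {x : ℝ} (hx : x ∈ I.right.toSet) :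
    h 0 I x = -(√I.len)⁻¹ := by
  simp [h, hx, Set.disjoint_right.1 (disjoint_left_right I) hx]

theorem h_one_of_mem {I : DyadicInterval} {x : ℝ} (hx : x ∈ I.toSet) : h 1 I x = I.len⁻¹ := by
  simp [h, hx]

theorem pairing_comm (f g : ℝ → ℝ) : pairing f g = pairing g f := by
  simp only [pairing, mul_comm]

theorem pairing_one_h_zero (c : ℝ) (J : DyadicInterval) : pairing (fun _ => c) (h 0 J) = 0 := by
  rw [pairing_h_zero (dyadicIntegrable_const c), diff, mass_const, mass_const, len_left, len_right,
    sub_self, mul_zero]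

theorem mul_h_of_const {f : ℝ → ℝ} {J : DyadicInterval} {c : ℝ} (hf : ∀ x ∈ J.toSet, f x = c)
    (x : ℝ) : f x * h 0 J x = c * h 0 J x := by
  by_cases hx : x ∈ J.toSet
  · rw [hf x hx]
  · rw [h_zero_of_notMem hx, mul_zero, mul_zero]

theorem pairing_h_zero_of_const {f : ℝ → ℝ} {J : DyadicInterval} {c : ℝ}
    (hf : ∀ x ∈ J.toSet, f x = c) : pairing f (h 0 J) = 0 := by
  rw [← pairing_one_h_zero c J]
  exact integral_congr_ae (.of_forall (mul_h_of_const hf))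

theorem pairing_h_one_of_const {f : ℝ → ℝ} {J : DyadicInterval} {c : ℝ}
    (hf : ∀ x ∈ J.toSet, f x = c) : pairing f (h 1 J) = c := by
  have := J.len_pos
  rw [pairing_h_one, mass, setIntegral_congr_fun (measurableSet_toSet J) hf]
  have := mass_const c J
  rw [mass] at this
  rw [this]
  field_simp

/-- The average `⟨h_J⟩_I`. -/
def haarAvg (I J : DyadicInterval) : ℝ := pairing (h 0 J) (h 1 I)

theorem haarAvg_self (I : DyadicInterval) : haarAvg I I = 0 := by
  rw [haarAvg, pairing_comm]
  exact pairing_h_zero_of_const fun x hx => h_one_of_mem hx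

open Classical in
/-- The product formula for Haar functions. -/
theorem h_mul_h (I J : DyadicInterval) (x : ℝ) : h 0 I x * h 0 J x =
    haarAvg I J * h 0 I x + haarAvg J I * h 0 J x + if I = J then h 1 J x else 0 := by
  have key : ∀ {I J : DyadicInterval}, I.n < J.n → ∀ x, h 0 I x * h 0 J x =
      haarAvg I J * h 0 I x + haarAvg J I * h 0 J x := by
    intro I J hlt x
    -- The Haar function of the longer interval is constant on the shorter one, so the product is
    -- that constant times `h_J`, while the mean of `h_J` over `I` vanishes.
    have hd : ∀ c : ℝ, (∀ x ∈ J.toSet, h 0 I x = c) →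
        (∀ x ∈ J.toSet, x ∈ I.toSet) ∨ (∀ x ∈ J.toSet, x ∉ I.toSet) →
        h 0 I x * h 0 J x = haarAvg I J * h 0 I x + haarAvg J I * h 0 J x := by
      intro c hc hI
      have e1 : haarAvg J I = c := pairing_h_one_of_const hc
      have e2 : haarAvg I J = 0 := by
        rw [haarAvg, pairing_comm]
        rcases hI with hI | hI
        · exact pairing_h_zero_of_const fun x hx => h_one_of_mem (hI x hx)
        · exact pairing_h_zero_of_const fun x hx => h_one_of_notMem (hI x hx)
      rw [e1, e2, zero_mul, zero_add]
      exact mul_h_of_const hc x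
    rcases nested_of_level_lt hlt with hJ | hJ | hJ
    · exact hd _ (fun x hx => h_zero_of_mem_left (hJ hx))
        (Or.inl fun x hx => left_subset I (hJ hx))
    · exact hd _ (fun x hx => h_zero_of_mem_right (hJ hx))
        (Or.inl fun x hx => right_subset I (hJ hx))
    · have hx' : ∀ x ∈ J.toSet, x ∉ I.toSet := fun x hx hI => Set.disjoint_left.1 hJ hI hx
      exact hd 0 (fun x hx => h_zero_of_notMem (hx' x hx)) (Or.inr hx')
  rcases lt_trichotomy I.n J.n with hn | hn | hn
  · rw [if_neg (fun e => by rw [e] at hn; exact lt_irrefl _ hn), add_zero]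
    exact key hn x
  · by_cases e : I = J
    · subst e
      rw [if_pos rfl, haarAvg_self]
      by_cases hx : x ∈ I.toSet
      · have hl := I.len_pos
        have : (√I.len)⁻¹ * (√I.len)⁻¹ = I.len⁻¹ := by
          rw [← mul_inv, Real.mul_self_sqrt hl.le]
        rw [h_one_of_mem hx, ← this]
        rw [← left_union_right] at hx
        rcases hx with hx | hx
        · rw [h_zero_of_mem_left hx]; ring
        · rw [h_zero_of_mem_right hx]; ring
      · rw [h_zero_of_notMem hx, h_one_of_notMem hx]; ring
    · have hd := disjoint_of_level_eq hn e
      rw [if_neg e, add_zero]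
      have h1 : ∀ x ∈ I.toSet, h 1 J x = 0 := fun x hx =>
        h_one_of_notMem (Set.disjoint_left.1 hd hx)
      have h2 : ∀ x ∈ J.toSet, h 1 I x = 0 := fun x hx =>
        h_one_of_notMem (Set.disjoint_right.1 hd hx)
      rw [haarAvg, haarAvg, pairing_comm, pairing_h_zero_of_const h2, pairing_comm,
        pairing_h_zero_of_const h1]
      by_cases hx : x ∈ I.toSet
      · rw [h_zero_of_notMem (Set.disjoint_left.1 hd hx)]; ring
      · rw [h_zero_of_notMem hx]; ring
  · rw [if_neg (fun e => by rw [e] at hn; exact lt_irrefl _ hn), add_zero, mul_comm, add_comm]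
    exact key hn x

open Classical in
/-- Integrating the product formula. -/
theorem integral_mul_h_mul_h {u : ℝ → ℝ} (hu : DyadicIntegrable u) (I J : DyadicInterval) :
    ∫ x, u x * (h 0 I x * h 0 J x) = haarAvg I J * haarCoeff u I + haarAvg J I * haarCoeff u J +
      if I = J then mass u J / J.len else 0 := by
  have e : (fun x => u x * (h 0 I x * h 0 J x)) = fun x => haarAvg I J * (u x * h 0 I x) +
      haarAvg J I * (u x * h 0 J x) + if I = J then u x * h 1 J x else 0 := by
    funext x
    rw [h_mul_h]
    split_ifs <;> ring
  have i1 := (integrable_mul_h_zero hu I).const_mul (haarAvg I J)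
  have i2 := (integrable_mul_h_zero hu J).const_mul (haarAvg J I)
  rw [e]
  by_cases hIJ : I = J
  · simp only [hIJ, if_true] at *
    have i3 : Integrable fun x => haarAvg J J * (u x * h 0 J x) + haarAvg J J * (u x * h 0 J x) :=
      i2.add i2
    rw [integral_add i3, integral_add i2 i2, integral_const_mul, ← pairing_h_one]
    · rfl
    · have : (fun x => u x * h 1 J x) = fun x => J.len⁻¹ * J.toSet.indicator u x := by
        funext x
        by_cases hx : x ∈ J.toSet <;> simp [h, hx]
        ring
      rw [this]
      exact ((integrable_indicator_iff (measurableSet_toSet _)).2 (hu _)).const_mul _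
  · simp only [hIJ, if_false, add_zero]
    rw [integral_add i1 i2, integral_const_mul, integral_const_mul]
    rfl

/-! ### The Haar basis of `L²(ℝ)` -/

theorem coeFn_hL2 (α : Fin 2) (I : DyadicInterval) : ⇑(hL2 α I) =ᵐ[volume] h α I :=
  (memLp_h α I).coeFn_toLp

theorem inner_eq_pairing (f g : L2R) : inner ℝ f g = pairing f g := by
  rw [L2.inner_def, pairing]
  simp [mul_comm]

theorem inner_hL2 (f : L2R) (α : Fin 2) (I : DyadicInterval) :
    inner ℝ f (hL2 α I) = pairing f (h α I) := by
  rw [inner_eq_pairing, pairing, pairing]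
  apply integral_congr_ae
  filter_upwards [coeFn_hL2 α I] with x hx
  rw [hx]

theorem dyadicIntegrable_of_memLp {f : ℝ → ℝ} (hf : MemLp f 2 volume) : DyadicIntegrable f :=
  fun I => by
    have : IsFiniteMeasure (volume.restrict I.toSet) :=
      ⟨by rw [Measure.restrict_apply_univ]; exact volume_toSet_lt_top I⟩
    exact (hf.restrict I.toSet).integrable (by norm_num)

theorem dyadicIntegrable_coe (f : L2R) : DyadicIntegrable f := dyadicIntegrable_of_memLp (Lp.memLp f)

theorem inner_hL2_hL2 (α β : Fin 2) (I J : DyadicInterval) :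
    inner ℝ (hL2 α I) (hL2 β J) = pairing (h α I) (h β J) := by
  rw [inner_hL2, pairing, pairing]
  apply integral_congr_ae
  filter_upwards [coeFn_hL2 α I] with x hx
  rw [hx]

theorem orthonormal_hL2 : Orthonormal ℝ (hL2 0) := by
  classical
  rw [orthonormal_iff_ite]
  intro I J
  have h1 := integral_mul_h_mul_h (dyadicIntegrable_const 1) I J
  have h2 : ∀ J, haarCoeff (fun _ => (1 : ℝ)) J = 0 := fun J => pairing_one_h_zero 1 J
  simp only [h2, mul_zero, zero_add, one_mul, mass_const] at h1
  rw [inner_hL2_hL2, pairing, h1]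
  have := J.len_pos
  split_ifs
  · field_simp
  · rfl

theorem mass_sq_le {f : ℝ → ℝ} (hf : MemLp f 2 volume) (I : DyadicInterval) :
    mass f I ^ 2 ≤ I.len ^ 2 * ‖(hL2 1 I)‖ ^ 2 * ‖hf.toLp f‖ ^ 2 := by
  have h1 : mass f I = I.len * inner ℝ (hf.toLp f) (hL2 1 I) := by
    have : pairing (hf.toLp f) (h 1 I) = pairing f (h 1 I) := by
      apply integral_congr_ae
      filter_upwards [hf.coeFn_toLp] with x hx
      rw [hx]
    have hl := I.len_pos
    rw [inner_hL2, this, pairing_h_one]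
    field_simp
  rw [h1, mul_pow, mul_assoc]
  have := real_inner_mul_inner_self_le (hf.toLp f) (hL2 1 I)
  rw [real_inner_self_eq_norm_sq, real_inner_self_eq_norm_sq] at this
  apply mul_le_mul_of_nonneg_left _ (sq_nonneg _)
  nlinarith

theorem norm_hL2_one_sq (I : DyadicInterval) : ‖hL2 1 I‖ ^ 2 = I.len⁻¹ := by
  rw [← real_inner_self_eq_norm_sq, inner_hL2_hL2]
  exact pairing_h_one_of_const fun x hx => h_one_of_mem hx

theorem mass_coe_sq_le (f : L2R) (I : DyadicInterval) : mass f I ^ 2 ≤ I.len * ‖f‖ ^ 2 := by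
  have h1 := mass_sq_le (Lp.memLp f) I
  have hl := I.len_pos
  rw [norm_hL2_one_sq, Lp.toLp_coeFn] at h1
  refine h1.trans_eq ?_
  field_simp

/-- Orthogonality to all Haar functions makes the integral double with each passage to the parent,
whereas Cauchy-Schwarz permits growth only like the square root of the length. -/
theorem mass_eq_zero_of_orthogonal {f : L2R} (hf : ∀ I, inner ℝ f (hL2 0 I) = 0)
    (I : DyadicInterval) : mass f I = 0 := by
  have hdiff : ∀ I : DyadicInterval, mass f I.left = mass f I.right := fun I => by
    have := hf I
    rw [inner_hL2, pairing_h_zero (dyadicIntegrable_coe f)] at this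
    have hl := Real.sqrt_pos.2 I.len_pos
    have h2 := (mul_eq_zero.1 this).resolve_left (by positivity)
    exact sub_eq_zero.1 h2
  have key : ∀ (N : ℕ) (I : DyadicInterval), 2 ^ N * mass f I ^ 2 ≤ I.len * ‖f‖ ^ 2 := by
    intro N
    induction N with
    | zero => intro I; simpa using mass_coe_sq_le f I
    | succ N ih =>
      intro I
      obtain ⟨K, -, hK⟩ := exists_parent I
      have h1 := ih K
      have h2 := isAdditive_mass (dyadicIntegrable_coe f) K
      have h3 := hdiff K
      have h4 : I.len = K.len / 2 := by
        rcases hK with rfl | rfl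
        · exact len_left K
        · exact len_right K
      have h5 : mass f K = 2 * mass f I := by
        rcases hK with rfl | rfl <;> linarith
      rw [h5] at h1
      rw [h4, pow_succ]
      nlinarith
  by_contra hne
  have hpos : 0 < mass f I ^ 2 := by positivity
  obtain ⟨N, hN⟩ := pow_unbounded_of_one_lt (I.len * ‖f‖ ^ 2 / mass f I ^ 2)
    (one_lt_two (α := ℝ))
  rw [div_lt_iff₀ hpos] at hN
  exact absurd (key N I) (not_le.2 hN)

/-- Lebesgue differentiation along the dyadic intervals containing `x`. Up to an endpoint these are
closed balls that contain `x` without being centred there, which the differentiation theorem for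
doubling measures allows. -/
theorem ae_eq_zero_of_mass_eq_zero {f : ℝ → ℝ} (hf : LocallyIntegrable f volume)
    (h0 : ∀ I, mass f I = 0) : f =ᵐ[volume] 0 := by
  filter_upwards [IsUnifLocDoublingMeasure.ae_tendsto_average volume hf 1] with x hx
  have hmem : ∀ j : ℕ, ∃ I : DyadicInterval, I.len = (1 / 2) ^ j ∧ x ∈ I.toSet := fun j => by
    refine ⟨⟨j, ⌊x / (DyadicInterval.mk j 0).len⌋⟩, ?_, ?_⟩
    · simp [len]
    · rw [mem_toSet_iff]; rfl
  choose K hK hxK using hmem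
  have hδ : Tendsto (fun j : ℕ => ((1 / 2 : ℝ) ^ j) / 2) atTop (𝓝[>] 0) := by
    refine tendsto_nhdsWithin_iff.2 ⟨?_, .of_forall fun j => ?_⟩
    · have := (tendsto_pow_atTop_nhds_zero_of_lt_one (r := (1 / 2 : ℝ)) (by norm_num)
        (by norm_num)).div_const 2
      simpa using this
    · simp only [Set.mem_Ioi]; positivity
  have hball : ∀ j, Metric.closedBall (((K j).k + 1 / 2) * (K j).len) (((1 / 2 : ℝ) ^ j) / 2) =
      Set.Icc ((K j).k * (K j).len) (((K j).k + 1) * (K j).len) := fun j => by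
    rw [Real.closedBall_eq_Icc, ← hK j]
    congr 1 <;> ring
  have := hx (fun j => ((K j).k + 1 / 2) * (K j).len) (fun j => ((1 / 2 : ℝ) ^ j) / 2) hδ
    (.of_forall fun j => by
      rw [one_mul, hball]
      exact Set.Ico_subset_Icc_self (hxK j))
  refine tendsto_nhds_unique this ?_
  have e : ∀ j, ⨍ y in Metric.closedBall (((K j).k + 1 / 2) * (K j).len) (((1 / 2 : ℝ) ^ j) / 2),
      f y = 0 := fun j => by
    rw [hball, setAverage_eq, integral_Icc_eq_integral_Ico]
    have := h0 (K j)
    rw [mass, toSet] at this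
    rw [this, smul_zero]
  simp only [e]
  exact tendsto_const_nhds

/-- The Haar basis. -/
def haarBasis : HilbertBasis DyadicInterval ℝ L2R :=
  HilbertBasis.mkOfOrthogonalEqBot orthonormal_hL2 (by
    rw [Submodule.eq_bot_iff]
    intro f hf
    have h1 : ∀ I, inner ℝ f (hL2 0 I) = 0 := fun I => by
      rw [real_inner_comm]
      exact hf _ (Submodule.subset_span ⟨I, rfl⟩)
    rw [Lp.eq_zero_iff_ae_eq_zero]
    exact ae_eq_zero_of_mass_eq_zero ((Lp.memLp f).locallyIntegrable (by norm_num))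
      (mass_eq_zero_of_orthogonal h1))

theorem coe_haarBasis : ⇑haarBasis = hL2 0 := HilbertBasis.coe_mkOfOrthogonalEqBot _ _

theorem dense_span_hL2 : Dense (Submodule.span ℝ (Set.range (hL2 0)) : Set L2R) := by
  have := haarBasis.dense_span
  rw [coe_haarBasis] at this
  exact (Submodule.dense_iff_topologicalClosure_eq_top).2 this

theorem hasSum_inner_mul_inner (f g : L2R) :
    HasSum (fun I => inner ℝ f (hL2 0 I) * inner ℝ g (hL2 0 I)) (inner ℝ f g) := by
  have := haarBasis.hasSum_inner_mul_inner f g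
  simp only [coe_haarBasis] at this
  simpa only [real_inner_comm g] using this

theorem sum_inner_sq_le (f : L2R) (s : Finset DyadicInterval) :
    ∑ I ∈ s, inner ℝ f (hL2 0 I) ^ 2 ≤ ‖f‖ ^ 2 := by
  have := orthonormal_hL2.sum_inner_products_le (s := s) f
  simpa only [real_inner_comm f, Real.norm_eq_abs, sq_abs] using this

theorem norm_sum_sq (t : DyadicInterval → ℝ) (s : Finset DyadicInterval) :
    ‖∑ I ∈ s, t I • hL2 0 I‖ ^ 2 = ∑ I ∈ s, t I ^ 2 := by
  rw [← real_inner_self_eq_norm_sq, orthonormal_hL2.inner_sum]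
  simp [sq]

/-! ### Multiplication by functions that are square integrable on dyadic intervals -/

/-- Square integrability on all dyadic intervals. -/
def DyadicL2 (a : ℝ → ℝ) : Prop := ∀ I : DyadicInterval, MemLp a 2 (volume.restrict I.toSet)

theorem sq_integral_mul_le {μ : Measure ℝ} {f g : ℝ → ℝ} (hf : MemLp f 2 μ) (hg : MemLp g 2 μ) :
    (∫ x, f x * g x ∂μ) ^ 2 ≤ (∫ x, f x ^ 2 ∂μ) * ∫ x, g x ^ 2 ∂μ := by
  have key : ∀ {f g : ℝ → ℝ} (hf : MemLp f 2 μ) (hg : MemLp g 2 μ),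
      inner ℝ (hf.toLp f) (hg.toLp g) = ∫ x, f x * g x ∂μ := by
    intro f g hf hg
    rw [L2.inner_def]
    apply integral_congr_ae
    filter_upwards [hf.coeFn_toLp, hg.coeFn_toLp] with x h1 h2
    rw [h1, h2]
    simp [mul_comm]
  have := real_inner_mul_inner_self_le (hf.toLp f) (hg.toLp g)
  rw [key, key, key] at this
  simpa only [sq] using this

section DyadicL2

variable {a f : ℝ → ℝ}

theorem dyadicL2_of_memLp (hf : MemLp f 2 volume) : DyadicL2 f := fun _ => hf.restrict _

theorem DyadicL2.integrable (ha : DyadicL2 a) : DyadicIntegrable a := fun I => by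
  have : IsFiniteMeasure (volume.restrict I.toSet) :=
    ⟨by rw [Measure.restrict_apply_univ]; exact volume_toSet_lt_top I⟩
  exact (ha I).integrable (by norm_num)

theorem DyadicL2.integrable_mul (ha : DyadicL2 a) (hf : DyadicL2 f) :
    DyadicIntegrable fun x => a x * f x := fun I => (ha I).integrable_mul (hf I)

theorem DyadicL2.integrable_sq (ha : DyadicL2 a) : DyadicIntegrable fun x => a x ^ 2 :=
  fun I => (ha I).integrable_sq

theorem DyadicL2.abs (ha : DyadicL2 a) : DyadicL2 fun x => |a x| := fun I => (ha I).abs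

theorem dyadicL2_one : DyadicL2 fun _ => 1 := fun I => by
  have : IsFiniteMeasure (volume.restrict I.toSet) :=
    ⟨by rw [Measure.restrict_apply_univ]; exact volume_toSet_lt_top I⟩
  exact memLp_const 1

theorem mass_nonneg (hf : ∀ x, 0 ≤ f x) (I : DyadicInterval) : 0 ≤ mass f I :=
  setIntegral_nonneg (measurableSet_toSet I) fun x _ => hf x

theorem isTest_mass (ha : DyadicL2 a) (ha0 : ∀ x, 0 ≤ a x) (hf : DyadicL2 f) :
    IsTest (mass fun x => a x ^ 2) (mass fun x => a x * f x) (mass fun x => a x * |f x|)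
      (mass fun x => f x ^ 2) where
  nonneg := mass_nonneg fun x => mul_nonneg (ha0 x) (abs_nonneg _)
  add_left := isAdditive_mass (ha.integrable_mul hf.abs)
  add_right := isAdditive_mass hf.integrable_sq
  sq_le := fun I => by
    have := sq_integral_mul_le (ha I) (hf.abs I)
    simp only [sq_abs] at this
    rw [mul_comm]
    exact this
  add := isAdditive_mass (ha.integrable_mul hf)
  abs_le := fun I => by
    refine (abs_integral_le_integral_abs).trans_eq ?_
    simp only [abs_mul, abs_of_nonneg (ha0 _)]
    rfl

theorem isTest_len (hf : DyadicL2 f) :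
    IsTest len (mass f) (mass fun x => |f x|) (mass fun x => f x ^ 2) := by
  have := isTest_mass dyadicL2_one (fun _ => zero_le_one) hf
  have e : (mass fun _ => (1 : ℝ) ^ 2) = len := by
    funext I; rw [mass_const]; ring
  rw [e] at this
  simpa only [one_mul] using this

theorem mass_sq_coe_le (f : L2R) (I : DyadicInterval) : mass (fun x => f x ^ 2) I ≤ ‖f‖ ^ 2 := by
  rw [← real_inner_self_eq_norm_sq, inner_eq_pairing, pairing, mass]
  simp only [← sq]
  exact setIntegral_le_integral (Lp.memLp f).integrable_sq (.of_forall fun x => sq_nonneg _)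

theorem memLp_mul_h_zero (ha : DyadicL2 a) (J : DyadicInterval) :
    MemLp (fun x => a x * h 0 J x) 2 volume := by
  rw [mul_h_zero]
  exact (((memLp_indicator_iff_restrict (measurableSet_toSet _)).2 (ha _)).sub
    ((memLp_indicator_iff_restrict (measurableSet_toSet _)).2 (ha _))).const_mul _

/-- The function `a h_J` as an element of `L²(ℝ)`. -/
def mulHaar (ha : DyadicL2 a) (J : DyadicInterval) : L2R := (memLp_mul_h_zero ha J).toLp _

theorem coeFn_mulHaar (ha : DyadicL2 a) (J : DyadicInterval) :
    ⇑(mulHaar ha J) =ᵐ[volume] fun x => a x * h 0 J x := MemLp.coeFn_toLp _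

theorem inner_mulHaar (ha : DyadicL2 a) (f : L2R) (J : DyadicInterval) :
    inner ℝ f (mulHaar ha J) = (√J.len)⁻¹ * diff (mass fun x => a x * f x) J := by
  rw [← pairing_h_zero (ha.integrable_mul (dyadicL2_of_memLp (Lp.memLp f))), inner_eq_pairing,
    pairing, pairing]
  apply integral_congr_ae
  filter_upwards [coeFn_mulHaar ha J] with x hx
  rw [hx]; ring

theorem haarAvg_eq_inner (I J : DyadicInterval) : haarAvg I J = inner ℝ (hL2 1 I) (hL2 0 J) := by
  rw [inner_hL2_hL2, haarAvg, pairing_comm]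

open Classical in
theorem inner_mulHaar_hL2 (ha : DyadicL2 a) (I J : DyadicInterval) :
    inner ℝ (mulHaar ha J) (hL2 0 I) = haarAvg I J * haarCoeff a I + haarAvg J I * haarCoeff a J +
      if I = J then mass a J / J.len else 0 := by
  rw [← integral_mul_h_mul_h ha.integrable, inner_hL2, pairing]
  apply integral_congr_ae
  filter_upwards [coeFn_mulHaar ha J] with x hx
  rw [hx]; ring

/-- The element of `L²(ℝ)` representing the `J`-th Haar coefficient of `P^{(1,0)}_{â} f`. -/
def corrHaar (ha : DyadicL2 a) (J : DyadicInterval) : L2R :=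
  mulHaar ha J - (mass a J / J.len) • hL2 0 J - haarCoeff a J • hL2 1 J

/-- By the product formula, the two subtractions remove from `a h_J` exactly the diagonal and the
transposed paraproduct; what is left is the matrix of `P^{(1,0)}_â`. -/
theorem inner_corrHaar_hL2 (ha : DyadicL2 a) (I J : DyadicInterval) :
    inner ℝ (corrHaar ha J) (hL2 0 I) = haarCoeff a I * haarAvg I J := by
  classical
  rw [corrHaar, inner_sub_left, inner_sub_left, inner_mulHaar_hL2, real_inner_smul_left,
    real_inner_smul_left, ← haarAvg_eq_inner, orthonormal_iff_ite.1 orthonormal_hL2]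
  by_cases h : I = J
  · simp only [h, if_true]; ring
  · simp only [h, Ne.symm h, if_false]; ring

theorem inner_corrHaar (ha : DyadicL2 a) (f : L2R) (J : DyadicInterval) :
    inner ℝ f (corrHaar ha J) =
      (√J.len)⁻¹ * innerCoeff (mass fun x => a x * f x) (mass f) (mass a) J := by
  rw [corrHaar, inner_sub_right, inner_sub_right, inner_mulHaar, real_inner_smul_right,
    real_inner_smul_right, inner_hL2, inner_hL2, pairing_h_zero (dyadicIntegrable_coe f),
    pairing_h_one, haarCoeff, pairing_h_zero ha.integrable, innerCoeff]
  ring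

theorem hasSum_inner_corrHaar (ha : DyadicL2 a) (f : L2R) (J : DyadicInterval) :
    HasSum (fun I => inner ℝ f (hL2 0 I) * (haarCoeff a I * haarAvg I J))
      (inner ℝ f (corrHaar ha J)) := by
  simpa only [inner_corrHaar_hL2] using hasSum_inner_mul_inner f (corrHaar ha J)

/-- The Haar coefficients of the paraproduct `P^{(1,0)}_{â} f`. -/
theorem inner_paraproduct (ha : DyadicL2 a) {f : L2R}
    (hf : ParaproductConverges 1 0 (haarCoeff a) f) (J : DyadicInterval) :
    inner ℝ (paraproduct 1 0 (haarCoeff a) f) (hL2 0 J) = inner ℝ f (corrHaar ha J) := by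
  have h1 := hf.hasSum.mapL (innerSL ℝ (hL2 0 J))
  simp only [innerSL_apply_apply] at h1
  rw [real_inner_comm, paraproduct]
  refine h1.unique ?_
  refine (hasSum_inner_corrHaar ha f J).congr_fun ?_
  intro I
  rw [paraproductTerm, real_inner_smul_right, real_inner_comm, ← haarAvg_eq_inner, inner_hL2]
  ring

end DyadicL2

/-! ### Dyadic `A₂` weights -/

/-- An `A₂` weight with characteristic at most `Q`, in terms of real integrals. -/
structure IsA2Weight (Q : ℝ) (ω : ℝ → ℝ) : Prop where
  nonneg : ∀ x, 0 ≤ ω x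
  pos : ∀ᵐ x, 0 < ω x
  measurable : AEStronglyMeasurable ω volume
  integrable : DyadicIntegrable ω
  integrable_inv : DyadicIntegrable fun x => (ω x)⁻¹
  le : ∀ I, mass ω I * mass (fun x => (ω x)⁻¹) I ≤ Q * I.len ^ 2

section Weight

variable {Q : ℝ} {ω : ℝ → ℝ}

theorem IsA2Weight.inv (h : IsA2Weight Q ω) : IsA2Weight Q fun x => (ω x)⁻¹ where
  nonneg := fun x => inv_nonneg.2 (h.nonneg x)
  pos := h.pos.mono fun x hx => inv_pos.2 hx
  measurable := h.measurable.aemeasurable.inv.aestronglyMeasurable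
  integrable := h.integrable_inv
  integrable_inv := by simpa only [inv_inv] using h.integrable
  le := fun I => by
    simp only [inv_inv]
    rw [mul_comm]; exact h.le I

theorem IsA2Weight.dyadicL2_sqrt (h : IsA2Weight Q ω) : DyadicL2 fun x => √(ω x) := fun I => by
  rw [memLp_two_iff_integrable_sq]
  · simp only [Real.sq_sqrt (h.nonneg _)]
    exact h.integrable I
  · exact (Real.continuous_sqrt.comp_aestronglyMeasurable h.measurable).restrict

theorem mass_pos {f : ℝ → ℝ} (hf : DyadicIntegrable f) (hpos : ∀ᵐ x, 0 < f x)
    (I : DyadicInterval) : 0 < mass f I := by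
  rw [mass, integral_pos_iff_support_of_nonneg_ae ((ae_restrict_of_ae hpos).mono
    fun x hx => hx.le) (hf I)]
  have h1 : Function.support f =ᵐ[volume.restrict I.toSet] Set.univ := by
    rw [eventuallyEq_univ]
    exact (ae_restrict_of_ae hpos).mono fun x hx => hx.ne'
  rw [measure_congr h1, Measure.restrict_apply_univ, volume_toSet]
  exact ENNReal.ofReal_pos.2 I.len_pos

theorem IsA2Weight.mass_sqrt_pos (h : IsA2Weight Q ω) (I : DyadicInterval) :
    0 < mass (fun x => √(ω x)) I :=
  mass_pos h.dyadicL2_sqrt.integrable (h.pos.mono fun _ hx => Real.sqrt_pos.2 hx) I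

theorem IsA2Weight.mass_sqrt_sq_le (h : IsA2Weight Q ω) (I : DyadicInterval) :
    mass (fun x => √(ω x)) I ^ 2 ≤ mass ω I * I.len := by
  have := (isTest_len h.dyadicL2_sqrt).sq_le I
  simp only [Real.sq_sqrt (h.nonneg _), abs_of_nonneg (Real.sqrt_nonneg _)] at this
  exact this

theorem IsA2Weight.isTest (h : IsA2Weight Q ω) (f : L2R) :
    IsTest (mass ω) (mass fun x => √(ω x) * f x) (mass fun x => √(ω x) * |f x|)
      (mass fun x => f x ^ 2) := by
  have := isTest_mass h.dyadicL2_sqrt (fun x => Real.sqrt_nonneg _)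
    (dyadicL2_of_memLp (Lp.memLp f))
  simpa only [Real.sq_sqrt (h.nonneg _)] using this

theorem IsA2Weight.isA2Pair (h : IsA2Weight Q ω) :
    IsA2Pair Q (mass fun x => (ω x)⁻¹) (mass ω) := by
  have hsq : ∀ I : DyadicInterval, I.len ^ 2 ≤ mass (fun x => (ω x)⁻¹) I * mass ω I := fun I => by
    have h1 := sq_integral_mul_le (h.dyadicL2_sqrt I) (h.inv.dyadicL2_sqrt I)
    have h2 : ∫ x in I.toSet, √(ω x) * √((ω x)⁻¹) = I.len := by
      rw [← mul_one I.len, ← mass_const 1 I, mass]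
      apply integral_congr_ae
      filter_upwards [ae_restrict_of_ae h.pos] with x hx
      rw [← Real.sqrt_mul hx.le, mul_inv_cancel₀ hx.ne', Real.sqrt_one]
    rw [h2] at h1
    simp only [Real.sq_sqrt (h.nonneg _), Real.sq_sqrt (h.inv.nonneg _)] at h1
    rw [mul_comm]; exact h1
  refine ⟨?_, mass_pos h.integrable_inv h.inv.pos, mass_pos h.integrable h.pos,
    isAdditive_mass h.integrable_inv, isAdditive_mass h.integrable, hsq,
    fun I => (mul_comm _ _).trans_le (h.le I)⟩
  have I : DyadicInterval := ⟨0, 0⟩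
  have h1 := hsq I
  have h2 := h.le I
  rw [mul_comm (mass ω I)] at h2
  have : 1 * I.len ^ 2 ≤ Q * I.len ^ 2 := by linarith
  exact le_of_mul_le_mul_right this (pow_pos I.len_pos 2)

theorem isA2Weight_of_A2char (hω : IsWeight ω) (hpos : ∀ᵐ x, 0 < ω x) (hA : A2char ω ≠ ⊤) :
    IsA2Weight (A2char ω).toReal ω := by
  have hmeas := hω.2.aestronglyMeasurable
  have hint : DyadicIntegrable ω := fun I =>
    (hω.2.integrableOn_isCompact isCompact_Icc).mono_set Set.Ico_subset_Icc_self
  have hinv : ∀ᵐ x, (ENNReal.ofReal (ω x))⁻¹ = ENNReal.ofReal (ω x)⁻¹ := by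
    filter_upwards [hpos] with x hx
    rw [ENNReal.ofReal_inv_of_pos hx]
  have hlint : ∀ I : DyadicInterval, ∫⁻ x in I.toSet, ENNReal.ofReal (ω x) =
      ENNReal.ofReal (mass ω I) := fun I =>
    (ofReal_integral_eq_lintegral_ofReal (hint I) (.of_forall hω.1)).symm
  have hlen : ∀ I : DyadicInterval, (ENNReal.ofReal I.len)⁻¹ = ENNReal.ofReal I.len⁻¹ := fun I =>
    (ENNReal.ofReal_inv_of_pos I.len_pos).symm
  have hle : ∀ I : DyadicInterval, ENNReal.ofReal (I.len⁻¹ * mass ω I * I.len⁻¹) *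
      (∫⁻ x in I.toSet, ENNReal.ofReal (ω x)⁻¹) ≤ A2char ω := fun I => by
    refine le_trans (le_of_eq ?_) (le_iSup _ I)
    have hl := I.len_pos
    have hm := mass_pos hint hpos I
    rw [dyadicAverage, dyadicAverage, hlint, hlen, lintegral_congr_ae (ae_restrict_of_ae hinv),
      ENNReal.ofReal_mul (by positivity), ENNReal.ofReal_mul (by positivity), mul_assoc, mul_assoc]
  -- Local integrability of `ω⁻¹` comes from finiteness of the characteristic: the average of `ω` is
  -- positive, so an infinite integral of `ω⁻¹` would make the supremum infinite.
  have hfin : ∀ I : DyadicInterval, ∫⁻ x in I.toSet, ENNReal.ofReal (ω x)⁻¹ ≠ ⊤ := fun I htop => by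
    have := hle I
    have hl := I.len_pos
    have hm := mass_pos hint hpos I
    rw [htop, ENNReal.mul_top (ENNReal.ofReal_pos.2 (by positivity)).ne', top_le_iff] at this
    exact hA this
  have hinvint : DyadicIntegrable fun x => (ω x)⁻¹ := fun I => by
    refine ⟨hmeas.aemeasurable.inv.aestronglyMeasurable.restrict, ?_⟩
    rw [hasFiniteIntegral_iff_ofReal (.of_forall fun x => inv_nonneg.2 (hω.1 x))]
    exact (hfin I).lt_top
  refine ⟨hω.1, hpos, hmeas, hint, hinvint, fun I => ?_⟩
  have h1 := hle I
  have hl := I.len_pos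
  have hm := mass_pos hint hpos I
  rw [← ofReal_integral_eq_lintegral_ofReal (hinvint I)
    (.of_forall fun x => inv_nonneg.2 (hω.1 x)), ← ENNReal.ofReal_mul (by positivity)] at h1
  have h2 := (ENNReal.ofReal_le_iff_le_toReal hA).1 h1
  have h3 := mul_le_mul_of_nonneg_right h2 (sq_nonneg I.len)
  refine le_trans (le_of_eq ?_) h3
  rw [mass]
  field_simp
  rfl

end Weight

/-! ### Square summable families along an orthonormal family -/

theorem summable_smul_of_sum_sq_le {v : DyadicInterval → L2R} (hv : Orthonormal ℝ v)
    {t : DyadicInterval → ℝ} {X : ℝ} (h : ∀ s : Finset DyadicInterval, ∑ I ∈ s, t I ^ 2 ≤ X) :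
    Summable fun I => t I • v I := by
  have h1 := (hv.orthogonalFamily.summable_iff_norm_sq_summable t).2 (by
    simp only [Real.norm_eq_abs, sq_abs]
    exact summable_of_sum_le (fun I => sq_nonneg _) h)
  simpa using h1

theorem norm_tsum_smul_sq_le {t : DyadicInterval → ℝ} {X : ℝ} (hX : 0 ≤ X)
    (h : ∀ s : Finset DyadicInterval, ∑ I ∈ s, t I ^ 2 ≤ X ^ 2) :
    ‖∑' I, t I • hL2 0 I‖ ≤ X := by
  refine le_of_tendsto (summable_smul_of_sum_sq_le orthonormal_hL2 h).hasSum.norm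
    (.of_forall fun s => ?_)
  exact le_of_sq_le_sq ((norm_sum_sq t s).trans_le (h s)) hX

theorem orthonormal_hL2_left : Orthonormal ℝ fun I : DyadicInterval => hL2 0 I.left :=
  orthonormal_hL2.comp left left_injective

theorem hasSum_haarShift (f : L2R) :
    HasSum (fun I : DyadicInterval => inner ℝ f (hL2 0 I) • hL2 0 I.left) (haarShift f) := by
  have := (summable_smul_of_sum_sq_le orthonormal_hL2_left (sum_inner_sq_le f)).hasSum
  simp only [haarShift, ← inner_hL2]
  exact this

theorem inner_haarShift_left (f : L2R) (J : DyadicInterval) :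
    inner ℝ (haarShift f) (hL2 0 J.left) = inner ℝ f (hL2 0 J) := by
  classical
  have h1 := (hasSum_haarShift f).mapL (innerSL ℝ (hL2 0 J.left))
  simp only [innerSL_apply_apply, real_inner_smul_right] at h1
  rw [real_inner_comm]
  refine h1.unique ?_
  have h2 := hasSum_ite_eq J (inner ℝ f (hL2 0 J))
  refine h2.congr_fun fun I => ?_
  rw [orthonormal_iff_ite.1 orthonormal_hL2]
  by_cases h : I = J
  · simp [h]
  · have : J.left ≠ I.left := fun e => h (left_injective e.symm)
    simp [h, this]

theorem inner_haarShift_eq_zero (f : L2R) {K : DyadicInterval} (hK : K ∉ Set.range left) :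
    inner ℝ (haarShift f) (hL2 0 K) = 0 := by
  classical
  have h1 := (hasSum_haarShift f).mapL (innerSL ℝ (hL2 0 K))
  simp only [innerSL_apply_apply, real_inner_smul_right] at h1
  rw [real_inner_comm]
  refine h1.unique ?_
  refine (hasSum_zero).congr_fun fun I => ?_
  rw [orthonormal_iff_ite.1 orthonormal_hL2, if_neg (fun e => hK ⟨I, e.symm⟩), mul_zero]

theorem sum_eq_sum_preimage_left {θ : DyadicInterval → ℝ} (h : ∀ K ∉ Set.range left, θ K = 0)
    (s : Finset DyadicInterval) :
    ∑ K ∈ s, θ K = ∑ J ∈ s.preimage left left_injective.injOn, θ J.left :=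
  (Finset.sum_preimage left s left_injective.injOn θ fun K _ hK => h K hK).symm

/-- Optimizing a quadratic estimate over dilations. -/
theorem le_of_forall_scaled {W X K : ℝ} (hX : 0 ≤ X) (hK : 0 < K)
    (h : ∀ ε : ℝ, ε * W ^ 2 ≤ K * (X ^ 2 + ε ^ 2 * W ^ 2)) : W ≤ 2 * K * X := by
  have h1 := h (1 / (2 * K))
  have h2 : W ^ 2 ≤ (2 * K * X) ^ 2 := by
    have e1 : K * (X ^ 2 + (1 / (2 * K)) ^ 2 * W ^ 2) = K * X ^ 2 + W ^ 2 / (4 * K) := by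
      field_simp; ring
    have e2 : 1 / (2 * K) * W ^ 2 = 2 * (W ^ 2 / (4 * K)) := by field_simp; ring
    rw [e1, e2] at h1
    have h3 : W ^ 2 / (4 * K) ≤ K * X ^ 2 := by linarith
    rw [div_le_iff₀ (by positivity)] at h3
    linarith
  exact le_of_sq_le_sq h2 (by positivity)

/-! ### Estimates for the composed paraproducts -/

namespace IsA2Weight

variable {Q : ℝ} {ω : ℝ → ℝ}

/-- The Haar coefficients of the inner paraproduct. -/
def coeff (h : IsA2Weight Q ω) (φ : L2R) (J : DyadicInterval) : ℝ :=
  inner ℝ φ (corrHaar h.inv.dyadicL2_sqrt J)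

theorem coeff_eq (h : IsA2Weight Q ω) (φ : L2R) (J : DyadicInterval) :
    h.coeff φ J = (√J.len)⁻¹ * innerCoeff (mass fun x => √(ω x)⁻¹ * φ x) (mass φ)
      (mass fun x => √(ω x)⁻¹) J := inner_corrHaar _ _ _

/-- The coefficients need not be square summable with a bound uniform in the weight; dividing by the
averages of `ω⁻¹` is the normalisation matched to the later Cauchy-Schwarz steps. -/
theorem sum_coeff_sq_le (h : IsA2Weight Q ω) (φ : L2R) (s : Finset DyadicInterval) :
    ∑ J ∈ s, h.coeff φ J ^ 2 * (J.len / mass (fun x => (ω x)⁻¹) J) ≤ 1938 * Q * ‖φ‖ ^ 2 := by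
  have hQ := h.isA2Pair.one_le
  have key := sum_le_of_treeSum_le (X := 969 * Q * ‖φ‖ ^ 2)
    (θ := fun J => innerCoeff (mass fun x => √(ω x)⁻¹ * φ x) (mass φ)
      (mass fun x => √(ω x)⁻¹) J ^ 2 / mass (fun x => (ω x)⁻¹) J)
    (fun J => div_nonneg (sq_nonneg _) (h.isA2Pair.pos_left J).le)
    (fun n I => (h.isA2Pair.treeSum_innerCoeff_sq_le (h.inv.isTest φ)
      (isTest_len (dyadicL2_of_memLp (Lp.memLp φ))) h.inv.mass_sqrt_pos
      (isAdditive_mass h.inv.dyadicL2_sqrt.integrable) h.inv.mass_sqrt_sq_le n I).trans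
      (mul_le_mul_of_nonneg_left (mass_sq_coe_le φ I) (by positivity))) s
  refine le_trans (Finset.sum_le_sum fun J _ => le_of_eq ?_) (key.trans_eq (by ring))
  have hl := J.len_pos
  rw [coeff_eq, mul_pow, inv_pow, Real.sq_sqrt hl.le]
  field_simp

theorem sum_coeff_mul_inner_le (h : IsA2Weight Q ω) (φ g : L2R) (s : Finset DyadicInterval) :
    ∑ J ∈ s, |h.coeff φ J * inner ℝ g (mulHaar h.dyadicL2_sqrt J.left)| ≤
      2400 * Q * (‖φ‖ ^ 2 + ‖g‖ ^ 2) := by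
  have hQ := h.isA2Pair.one_le
  have key := sum_le_of_treeSum_le (X := 600 * Q * (‖φ‖ ^ 2 + ‖g‖ ^ 2))
    (θ := fun J => |innerCoeff (mass fun x => √(ω x)⁻¹ * φ x) (mass φ)
      (mass fun x => √(ω x)⁻¹) J| * |diff (mass fun x => √(ω x) * g x) J.left| / J.len)
    (fun J => by have := J.len_pos; positivity)
    (fun n I => (h.isA2Pair.treeSum_innerCoeff_mul_le (h.inv.isTest φ)
      (isTest_len (dyadicL2_of_memLp (Lp.memLp φ))) (h.isTest g) h.inv.mass_sqrt_pos
      (isAdditive_mass h.inv.dyadicL2_sqrt.integrable) h.inv.mass_sqrt_sq_le n I).trans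
      (mul_le_mul_of_nonneg_left (add_le_add (mass_sq_coe_le φ I) (mass_sq_coe_le g I))
        (by positivity))) s
  have h2 : ∑ J ∈ s, |h.coeff φ J * inner ℝ g (mulHaar h.dyadicL2_sqrt J.left)| ≤
      ∑ J ∈ s, 2 * (|innerCoeff (mass fun x => √(ω x)⁻¹ * φ x) (mass φ)
      (mass fun x => √(ω x)⁻¹) J| * |diff (mass fun x => √(ω x) * g x) J.left| / J.len) := by
    refine Finset.sum_le_sum fun J _ => ?_
    have hl := J.len_pos
    rw [coeff_eq, inner_mulHaar, len_left, abs_mul, abs_mul, abs_mul,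
      abs_of_nonneg (by positivity : 0 ≤ (√J.len)⁻¹),
      abs_of_nonneg (by positivity : 0 ≤ (√(J.len / 2))⁻¹)]
    -- The normalisations of `h_J` and `h_{J₋}` together cost a factor at most 2, which with the two
    -- half-lines turns 600 into 2400.
    have h3 : (√J.len)⁻¹ * (√(J.len / 2))⁻¹ ≤ 2 * J.len⁻¹ := by
      rw [← mul_inv, ← Real.sqrt_mul hl.le]
      have : J.len / 2 ≤ √(J.len * (J.len / 2)) := by
        apply Real.le_sqrt_of_sq_le; nlinarith
      calc _ ≤ (J.len / 2)⁻¹ := inv_anti₀ (by positivity) this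
        _ = _ := by field_simp
    set A := |innerCoeff (mass fun x => √(ω x)⁻¹ * φ x) (mass φ) (mass fun x => √(ω x)⁻¹) J|
    set D := |diff (mass fun x => √(ω x) * g x) J.left|
    calc (√J.len)⁻¹ * A * ((√(J.len / 2))⁻¹ * D)
        = (√J.len)⁻¹ * (√(J.len / 2))⁻¹ * (A * D) := by ring
      _ ≤ 2 * J.len⁻¹ * (A * D) := mul_le_mul_of_nonneg_right h3 (by positivity)
      _ = _ := by ring
  rw [← Finset.mul_sum] at h2
  linarith

/-- Duality: the sum is tested against multiples `ε W` of itself, and optimising in `ε` turns the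
additive estimate into a norm bound, doubling 2400. -/
theorem norm_sum_coeff_smul_mulHaar_le (h : IsA2Weight Q ω) (φ : L2R)
    (s : Finset DyadicInterval) :
    ‖∑ J ∈ s, h.coeff φ J • mulHaar h.dyadicL2_sqrt J.left‖ ≤ 4800 * Q * ‖φ‖ := by
  have hQ := h.isA2Pair.one_le
  set W := ∑ J ∈ s, h.coeff φ J • mulHaar h.dyadicL2_sqrt J.left with hW
  have key := le_of_forall_scaled (W := ‖W‖) (X := ‖φ‖) (K := 2400 * Q) (norm_nonneg _)
    (by positivity) fun ε => by
      have h1 := h.sum_coeff_mul_inner_le φ (ε • W) s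
      have h2 : ε * ‖W‖ ^ 2 =
          ∑ J ∈ s, h.coeff φ J * inner ℝ (ε • W) (mulHaar h.dyadicL2_sqrt J.left) := by
        rw [← real_inner_self_eq_norm_sq, ← real_inner_smul_left]
        conv_lhs => rw [hW, inner_sum]
        refine Finset.sum_congr rfl fun J _ => ?_
        rw [real_inner_smul_right, ← hW]
      have h3 : ‖ε • W‖ ^ 2 = ε ^ 2 * ‖W‖ ^ 2 := by
        rw [norm_smul, mul_pow, Real.norm_eq_abs, sq_abs]
      rw [h2, ← h3]
      exact (Finset.sum_le_sum fun J _ => le_abs_self _).trans h1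
  linarith

/-- Multiplication by `√ω` need not be continuous on `L²`, so the bound passes from partial sums to
the limit by Fatou's lemma along an almost everywhere convergent subsequence. -/
theorem eLpNorm_sqrt_mul_le (h : IsA2Weight Q ω) {φ F : L2R}
    (hF : HasSum (fun J : DyadicInterval => h.coeff φ J • hL2 0 J.left) F) :
    eLpNorm (fun x => √(ω x) * F x) 2 volume ≤ ENNReal.ofReal (4800 * Q * ‖φ‖) := by
  obtain ⟨u, hu⟩ := exists_seq_tendsto (atTop : Filter (Finset DyadicInterval))
  have h1 := tendstoInMeasure_of_tendsto_Lp (Tendsto.comp hF hu)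
  obtain ⟨ns, -, h2⟩ := h1.exists_seq_tendsto_ae
  set P : ℕ → L2R := fun n => ∑ J ∈ u (ns n), h.coeff φ J • hL2 0 J.left with hP
  set R : ℕ → L2R := fun n => ∑ J ∈ u (ns n), h.coeff φ J • mulHaar h.dyadicL2_sqrt J.left with hR
  have hRP : ∀ n, ⇑(R n) =ᵐ[volume] fun x => √(ω x) * P n x := fun n => by
    have e1 : ∀ᵐ x, ∀ J, hL2 0 J x = DyadicInterval.h 0 J x := ae_all_iff.2 fun J => coeFn_hL2 0 J
    have e2 : ∀ᵐ x, ∀ J, mulHaar h.dyadicL2_sqrt J x = √(ω x) * DyadicInterval.h 0 J x :=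
      ae_all_iff.2 fun J => coeFn_mulHaar h.dyadicL2_sqrt J
    have e3 : ∀ (v : DyadicInterval → L2R), ∀ᵐ x,
        (∑ J ∈ u (ns n), h.coeff φ J • v J : L2R) x = ∑ J ∈ u (ns n), h.coeff φ J * v J x := by
      intro v
      have a1 := Lp.coeFn_finsetSum (u (ns n)) fun J => h.coeff φ J • v J
      have a2 : ∀ᵐ x, ∀ J, (h.coeff φ J • v J : L2R) x = h.coeff φ J * v J x :=
        ae_all_iff.2 fun J => Lp.coeFn_smul (h.coeff φ J) (v J)
      filter_upwards [a1, a2] with x b1 b2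
      rw [b1, Finset.sum_apply]
      exact Finset.sum_congr rfl fun J _ => b2 J
    filter_upwards [e1, e2, e3 fun J => mulHaar h.dyadicL2_sqrt J.left,
      e3 fun J => hL2 0 J.left] with x b1 b2 b3 b4
    rw [hR, hP]
    simp only
    rw [b3, b4, Finset.mul_sum]
    refine Finset.sum_congr rfl fun J _ => ?_
    rw [b1, b2]
    ring
  have h3 := Lp.eLpNorm_lim_le_liminf_eLpNorm (p := 2) (fun n => Lp.aestronglyMeasurable (R n))
    (fun x => √(ω x) * F x) (by
      have := ae_all_iff.2 hRP
      filter_upwards [h2, this] with x b1 b2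
      simp only [b2]
      exact b1.const_mul _)
  refine h3.trans ?_
  refine (liminf_le_liminf (v := fun _ => ENNReal.ofReal (4800 * Q * ‖φ‖))
    (.of_forall fun n => ?_)).trans_eq (by simp)
  rw [← Lp.enorm_def, ← ofReal_norm]
  exact ENNReal.ofReal_le_ofReal (h.norm_sum_coeff_smul_mulHaar_le φ _)

end IsA2Weight

/-! ### The outer paraproduct -/

namespace IsA2Weight

variable {Q : ℝ} {ω : ℝ → ℝ}

/-- The squared average of `√ω` over `J₋` is at most `2 Q |J| / σ(J)`, by Cauchy-Schwarz,
monotonicity of the mass and the `A₂` condition. This is exactly the weight in `sum_coeff_sq_le`. -/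
theorem sum_avg_mul_inner_sq_le (h : IsA2Weight Q ω) {φ F : L2R}
    (hF : ∀ J : DyadicInterval, inner ℝ F (hL2 0 J.left) = h.coeff φ J)
    (hF0 : ∀ K ∉ Set.range left, inner ℝ F (hL2 0 K) = 0) (s : Finset DyadicInterval) :
    ∑ K ∈ s, (mass (fun x => √(ω x)) K / K.len * inner ℝ F (hL2 0 K)) ^ 2 ≤
      3876 * Q ^ 2 * ‖φ‖ ^ 2 := by
  have hA := h.isA2Pair
  have hQ := hA.one_le
  rw [sum_eq_sum_preimage_left (fun K hK => by rw [hF0 K hK]; ring)]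
  have key := h.sum_coeff_sq_le φ (s.preimage left left_injective.injOn)
  have h1 : ∀ J ∈ s.preimage left left_injective.injOn,
      (mass (fun x => √(ω x)) J.left / J.left.len * inner ℝ F (hL2 0 J.left)) ^ 2 ≤
      2 * Q * (h.coeff φ J ^ 2 * (J.len / mass (fun x => (ω x)⁻¹) J)) := by
    intro J _
    have hl := J.len_pos
    have hs := hA.pos_left J
    have hw := hA.pos_right J
    have hwle : mass ω J.left ≤ mass ω J := by
      rw [hA.add_right J]; linarith [hA.pos_right J.right]
    rw [hF, mul_pow, div_pow]
    have h2 : mass (fun x => √(ω x)) J.left ^ 2 / J.left.len ^ 2 ≤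
        2 * Q * (J.len / mass (fun x => (ω x)⁻¹) J) := by
      have h3 : mass (fun x => √(ω x)) J.left ^ 2 ≤ mass ω J * J.left.len :=
        (h.mass_sqrt_sq_le J.left).trans (mul_le_mul_of_nonneg_right hwle J.left.len_pos.le)
      have h4 : mass (fun x => √(ω x)) J.left ^ 2 / J.left.len ^ 2 ≤
          mass ω J * J.left.len / J.left.len ^ 2 := div_le_div_of_nonneg_right h3 (sq_nonneg _)
      refine h4.trans ?_
      have h5 := hA.le_sq_len J
      rw [len_left, ← mul_div_assoc (2 * Q), div_le_div_iff₀ (by positivity) hs]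
      nlinarith [mul_le_mul_of_nonneg_right h5 hl.le]
    calc _ ≤ 2 * Q * (J.len / mass (fun x => (ω x)⁻¹) J) * h.coeff φ J ^ 2 :=
          mul_le_mul_of_nonneg_right h2 (sq_nonneg _)
      _ = _ := by ring
  have h2 := Finset.sum_le_sum h1
  rw [← Finset.mul_sum] at h2
  nlinarith [mul_le_mul_of_nonneg_left key (by positivity : 0 ≤ 2 * Q)]

theorem sum_haarCoeff_sq_le (h : IsA2Weight Q ω) (g : L2R) (s : Finset DyadicInterval) :
    ∑ J ∈ s, haarCoeff (fun x => √(ω x)) J.left ^ 2 * (mass (fun x => (ω x)⁻¹) J / J.len) *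
      inner ℝ g (hL2 1 J.left) ^ 2 ≤ 1536 * Q * ‖g‖ ^ 2 := by
  have hQ := h.isA2Pair.one_le
  have key := sum_le_of_treeSum_le (X := 768 * Q * ‖g‖ ^ 2)
    (θ := fun J => diff (mass fun x => √(ω x)) J.left ^ 2 * mass (fun x => (ω x)⁻¹) J /
      (J.left.len * J.len) * (mass g J.left / J.left.len) ^ 2)
    (fun J => by
      have := J.len_pos; have := J.left.len_pos; have := h.isA2Pair.pos_left J; positivity)
    (fun n I => (h.isA2Pair.treeSum_outer_le (isTest_len (dyadicL2_of_memLp (Lp.memLp g)))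
      h.mass_sqrt_pos (isAdditive_mass h.dyadicL2_sqrt.integrable) h.mass_sqrt_sq_le n I).trans
      (mul_le_mul_of_nonneg_left (mass_sq_coe_le g I) (by positivity))) s
  refine le_trans (Finset.sum_le_sum fun J _ => le_of_eq ?_) (key.trans_eq (by ring))
  have hl := J.left.len_pos
  rw [haarCoeff, pairing_h_zero h.dyadicL2_sqrt.integrable, inner_hL2, pairing_h_one, mul_pow,
    inv_pow, Real.sq_sqrt hl.le]
  field_simp

/-- These are the coefficients of `P^{(1,0)}` with symbol `√ω` applied to `F`. Tested against a
finite Haar sum `g`, they become a sum of Haar coefficients of `F` and of `√ω` times means of `g`;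
only left children contribute, since `F` lies in the range of the shift. -/
theorem sum_inner_corrHaar_sq_le (h : IsA2Weight Q ω) {φ F : L2R}
    (hF : ∀ J : DyadicInterval, inner ℝ F (hL2 0 J.left) = h.coeff φ J)
    (hF0 : ∀ K ∉ Set.range left, inner ℝ F (hL2 0 K) = 0) (s : Finset DyadicInterval) :
    ∑ I ∈ s, inner ℝ F (corrHaar h.dyadicL2_sqrt I) ^ 2 ≤ (2000 * (Q * ‖φ‖)) ^ 2 := by
  have hA := h.isA2Pair
  have hQ := hA.one_le
  set η : DyadicInterval → ℝ := fun I => inner ℝ F (corrHaar h.dyadicL2_sqrt I) with hη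
  have main : ∀ t : DyadicInterval → ℝ, ∑ I ∈ s, t I * η I ≤
      1000 * ((Q * ‖φ‖) ^ 2 + ∑ I ∈ s, t I ^ 2) := by
    intro t
    set g : L2R := ∑ I ∈ s, t I • hL2 0 I with hg
    have hsum : HasSum (fun K => inner ℝ F (hL2 0 K) *
        (haarCoeff (fun x => √(ω x)) K * inner ℝ g (hL2 1 K))) (∑ I ∈ s, t I * η I) := by
      have := hasSum_sum fun I (_ : I ∈ s) =>
        (hasSum_inner_corrHaar h.dyadicL2_sqrt F I).mul_left (t I)
      refine this.congr_fun fun K => ?_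
      rw [hg, sum_inner, Finset.mul_sum, Finset.mul_sum]
      refine Finset.sum_congr rfl fun I _ => ?_
      rw [real_inner_smul_left, haarAvg_eq_inner, real_inner_comm (hL2 0 I)]
      ring
    refine le_of_tendsto hsum (.of_forall fun u => ?_)
    rw [sum_eq_sum_preimage_left (fun K hK => by rw [hF0 K hK]; ring)]
    set v := u.preimage left left_injective.injOn
    have h1 := h.sum_coeff_sq_le φ v
    have h2 := h.sum_haarCoeff_sq_le g v
    rw [hg, norm_sum_sq, ← hg] at h2
    -- The weights `Q / 2` and `1 / (2 Q)` balance the two square sums, giving `969 (Q ‖φ‖)²` and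
    -- `768 ∑ t²`, both within the constant 1000.
    have h3 : ∑ J ∈ v, inner ℝ F (hL2 0 J.left) * (haarCoeff (fun x => √(ω x)) J.left *
        inner ℝ g (hL2 1 J.left)) ≤
        ∑ J ∈ v, (Q / 2 * (h.coeff φ J ^ 2 * (J.len / mass (fun x => (ω x)⁻¹) J)) +
          1 / (2 * Q) * (haarCoeff (fun x => √(ω x)) J.left ^ 2 *
          (mass (fun x => (ω x)⁻¹) J / J.len) * inner ℝ g (hL2 1 J.left) ^ 2)) := by
      refine Finset.sum_le_sum fun J _ => ?_
      rw [hF]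
      have hl := J.len_pos
      have hs := hA.pos_left J
      set r := J.len / mass (fun x => (ω x)⁻¹) J with hr
      have hr0 : 0 < r := by positivity
      have hr' : mass (fun x => (ω x)⁻¹) J / J.len = r⁻¹ := by rw [hr, inv_div]
      rw [hr']
      set A := h.coeff φ J
      set B := haarCoeff (fun x => √(ω x)) J.left
      set D := inner ℝ g (hL2 1 J.left)
      have h4 : 0 ≤ (Q * r * A - B * D) ^ 2 / (2 * Q * r) := by positivity
      have e : (Q * r * A - B * D) ^ 2 / (2 * Q * r) =
          Q / 2 * (A ^ 2 * r) + 1 / (2 * Q) * (B ^ 2 * r⁻¹ * D ^ 2) - A * (B * D) := by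
        field_simp; ring
      linarith
    rw [Finset.sum_add_distrib, ← Finset.mul_sum, ← Finset.mul_sum] at h3
    have h5 := mul_le_mul_of_nonneg_left h1 (by positivity : 0 ≤ Q / 2)
    have h6 := mul_le_mul_of_nonneg_left h2 (by positivity : 0 ≤ 1 / (2 * Q))
    have e6 : 1 / (2 * Q) * (1536 * Q * ∑ I ∈ s, t I ^ 2) = 768 * ∑ I ∈ s, t I ^ 2 := by
      field_simp; ring
    have h7 : 0 ≤ ∑ I ∈ s, t I ^ 2 := Finset.sum_nonneg fun I _ => sq_nonneg _
    have h8 : 0 ≤ (Q * ‖φ‖) ^ 2 := sq_nonneg _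
    have e5 : Q / 2 * (1938 * Q * ‖φ‖ ^ 2) = 969 * (Q * ‖φ‖) ^ 2 := by ring
    linarith
  have hN : 0 ≤ ∑ I ∈ s, η I ^ 2 := Finset.sum_nonneg fun I _ => sq_nonneg _
  have key := le_of_forall_scaled (W := √(∑ I ∈ s, η I ^ 2)) (X := Q * ‖φ‖) (K := 1000)
    (by positivity) (by norm_num) fun ε => by
      rw [Real.sq_sqrt hN]
      have := main fun I => ε * η I
      simp only [mul_pow, ← Finset.mul_sum] at this
      have e : ∑ I ∈ s, ε * η I * η I = ε * ∑ I ∈ s, η I ^ 2 := by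
        rw [Finset.mul_sum]; exact Finset.sum_congr rfl fun I _ => by ring
      rw [e] at this
      simpa only [mul_pow] using this
  have := pow_le_pow_left₀ (Real.sqrt_nonneg _) key 2
  rw [Real.sq_sqrt hN] at this
  refine this.trans_eq (by ring)

/-- The definition of `corrHaar` expresses each outer coefficient through a Haar coefficient of `√ω
F` and two corrections. The three square sums contribute `3 * 4800²`, `3 * 3876` and `3 * 2000²`,
together less than `10000²`. -/
theorem sum_outer_sq_le (h : IsA2Weight Q ω) {φ F : L2R}
    (hF : ∀ J : DyadicInterval, inner ℝ F (hL2 0 J.left) = h.coeff φ J)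
    (hF0 : ∀ K ∉ Set.range left, inner ℝ F (hL2 0 K) = 0)
    (hG : eLpNorm (fun x => √(ω x) * F x) 2 volume ≤ ENNReal.ofReal (4800 * Q * ‖φ‖))
    (s : Finset DyadicInterval) :
    ∑ I ∈ s, (haarCoeff (fun x => √(ω x)) I * inner ℝ F (hL2 1 I)) ^ 2 ≤
      (10000 * Q * ‖φ‖) ^ 2 := by
  have hQ := h.isA2Pair.one_le
  have hmem : MemLp (fun x => √(ω x) * F x) 2 volume :=
    ⟨(Real.continuous_sqrt.comp_aestronglyMeasurable h.measurable).mul (Lp.aestronglyMeasurable F),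
      hG.trans_lt ENNReal.ofReal_lt_top⟩
  set G : L2R := hmem.toLp _ with hGdef
  have hGn : ‖G‖ ≤ 4800 * Q * ‖φ‖ := by
    rw [hGdef, Lp.norm_toLp]
    exact ENNReal.toReal_le_of_le_ofReal (by positivity) hG
  have hinner : ∀ I, inner ℝ F (mulHaar h.dyadicL2_sqrt I) = inner ℝ G (hL2 0 I) := fun I => by
    rw [inner_eq_pairing, inner_hL2, pairing, pairing]
    apply integral_congr_ae
    filter_upwards [coeFn_mulHaar h.dyadicL2_sqrt I, hmem.coeFn_toLp] with x h1 h2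
    rw [h1, hGdef, h2]; ring
  have hsplit : ∀ I, (haarCoeff (fun x => √(ω x)) I * inner ℝ F (hL2 1 I)) ^ 2 ≤
      3 * inner ℝ G (hL2 0 I) ^ 2 +
      3 * (mass (fun x => √(ω x)) I / I.len * inner ℝ F (hL2 0 I)) ^ 2 +
      3 * inner ℝ F (corrHaar h.dyadicL2_sqrt I) ^ 2 := fun I => by
    have e : inner ℝ F (corrHaar h.dyadicL2_sqrt I) = inner ℝ G (hL2 0 I) -
        mass (fun x => √(ω x)) I / I.len * inner ℝ F (hL2 0 I) -
        haarCoeff (fun x => √(ω x)) I * inner ℝ F (hL2 1 I) := by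
      rw [corrHaar, inner_sub_right, inner_sub_right, hinner, real_inner_smul_right,
        real_inner_smul_right]
    set A := inner ℝ G (hL2 0 I)
    set B := mass (fun x => √(ω x)) I / I.len * inner ℝ F (hL2 0 I)
    set D := inner ℝ F (corrHaar h.dyadicL2_sqrt I)
    have e2 : haarCoeff (fun x => √(ω x)) I * inner ℝ F (hL2 1 I) = A - B - D := by linarith
    rw [e2]
    nlinarith [sq_nonneg (A + B), sq_nonneg (A + D), sq_nonneg (B - D)]
  have h1 := Finset.sum_le_sum fun I (_ : I ∈ s) => hsplit I
  rw [Finset.sum_add_distrib, Finset.sum_add_distrib, ← Finset.mul_sum, ← Finset.mul_sum,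
    ← Finset.mul_sum] at h1
  have h2 := sum_inner_sq_le G s
  have h3 := h.sum_avg_mul_inner_sq_le hF hF0 s
  have h4 := h.sum_inner_corrHaar_sq_le hF hF0 s
  have h5 := pow_le_pow_left₀ (norm_nonneg _) hGn 2
  have h6 : 0 ≤ Q ^ 2 * ‖φ‖ ^ 2 := by positivity
  nlinarith

end IsA2Weight

/-! ### Linearity and assembly -/

theorem paraproductTerm_eq (α β : Fin 2) (b : DyadicInterval → ℝ) (f : L2R) (I : DyadicInterval) :
    paraproductTerm α β b f I = (b I * inner ℝ f (hL2 β I)) • hL2 α I := by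
  rw [paraproductTerm, inner_hL2]

theorem paraproductTerm_add (α β : Fin 2) (b : DyadicInterval → ℝ) (f g : L2R) :
    paraproductTerm α β b (f + g) = fun I => paraproductTerm α β b f I + paraproductTerm α β b g I := by
  funext I
  rw [paraproductTerm_eq, paraproductTerm_eq, paraproductTerm_eq, inner_add_left, mul_add, add_smul]

theorem paraproductTerm_smul (α β : Fin 2) (b : DyadicInterval → ℝ) (r : ℝ) (f : L2R) :
    paraproductTerm α β b (r • f) = fun I => r • paraproductTerm α β b f I := by
  funext I
  rw [paraproductTerm_eq, paraproductTerm_eq, real_inner_smul_left, smul_smul]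
  ring_nf

/-- The domain of a paraproduct. -/
def paraproductDomain (α β : Fin 2) (b : DyadicInterval → ℝ) : Submodule ℝ L2R where
  carrier := {f | ParaproductConverges α β b f}
  add_mem' := fun {f g} hf hg => by
    simp only [Set.mem_ofPred_eq, ParaproductConverges] at *
    rw [paraproductTerm_add]
    exact hf.add hg
  zero_mem' := by
    have : paraproductTerm α β b 0 = fun _ => 0 := by
      funext I
      rw [paraproductTerm_eq, inner_zero_left, mul_zero, zero_smul]
    simp only [Set.mem_ofPred_eq, ParaproductConverges]
    rw [this]
    exact summable_zero
  smul_mem' := fun r f hf => by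
    simp only [Set.mem_ofPred_eq, ParaproductConverges] at *
    rw [paraproductTerm_smul]
    exact hf.const_smul r

section Linear

variable {α β : Fin 2} {b : DyadicInterval → ℝ} {f g : L2R}

theorem paraproduct_add (hf : ParaproductConverges α β b f) (hg : ParaproductConverges α β b g) :
    paraproduct α β b (f + g) = paraproduct α β b f + paraproduct α β b g := by
  rw [paraproduct, paraproductTerm_add]
  exact hf.tsum_add hg

theorem paraproduct_smul (r : ℝ) (hf : ParaproductConverges α β b f) :
    paraproduct α β b (r • f) = r • paraproduct α β b f := by
  rw [paraproduct, paraproductTerm_smul]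
  exact hf.tsum_const_smul r

theorem haarShift_add (f g : L2R) : haarShift (f + g) = haarShift f + haarShift g :=
  (hasSum_haarShift (f + g)).unique (((hasSum_haarShift f).add (hasSum_haarShift g)).congr_fun
    fun I => by rw [inner_add_left, add_smul])

theorem haarShift_smul (r : ℝ) (f : L2R) : haarShift (r • f) = r • haarShift f :=
  (hasSum_haarShift (r • f)).unique (((hasSum_haarShift f).const_smul r).congr_fun
    fun I => by rw [real_inner_smul_left, smul_smul])

theorem span_hL2_le_paraproductDomain :
    Submodule.span ℝ (Set.range (hL2 0)) ≤ paraproductDomain α 0 b := by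
  classical
  rw [Submodule.span_le]
  rintro _ ⟨J, rfl⟩
  refine summable_of_ne_finset_zero (s := {J}) fun I hI => ?_
  rw [paraproductTerm_eq, orthonormal_iff_ite.1 orthonormal_hL2,
    if_neg (fun e => hI (Finset.mem_singleton.2 e.symm)), mul_zero, zero_smul]

end Linear

/-- A linear map, bounded on a dense subspace, extends to a bounded operator. -/
theorem exists_extension {E : Submodule ℝ L2R} (hE : Dense (E : Set L2R)) (A : E →ₗ[ℝ] L2R)
    {M : ℝ} (hM : 0 ≤ M) (hA : ∀ φ : E, ‖A φ‖ ≤ M * ‖(φ : L2R)‖) :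
    ∃ T : L2R →L[ℝ] L2R, ‖T‖ ≤ M ∧ ∀ φ : E, T φ = A φ := by
  have hdense : DenseRange E.subtypeL := by
    rw [DenseRange]
    convert hE
    ext x
    simp
  set A' : E →L[ℝ] L2R := A.mkContinuous M hA
  refine ⟨A'.extend E.subtypeL, ?_, fun φ => ?_⟩
  · have h1 := A'.opNorm_extend_le (e := E.subtypeL) (N := 1) hdense (fun x => by simp)
    rw [NNReal.coe_one, one_mul] at h1
    exact h1.trans (A.mkContinuous_norm_le hM hA)
  · exact A'.extend_eq hdense isUniformEmbedding_subtype_val.isUniformInducing φ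

end DyadicInterval

end

/-! ### The main theorem -/

open DyadicInterval

theorem mainTheorem1 :
    ∃ C : ℝ, 0 < C ∧ ∀ ω : ℝ → ℝ, IsWeight ω → (∀ᵐ x, 0 < ω x) → A2char ω ≠ ⊤ →
      -- the composition is defined on finite Haar sums, and densely defined
      (∀ φ ∈ Submodule.span ℝ (Set.range (DyadicInterval.hL2 0)),
        ParaproductConverges 1 0 (invSqrtCoeff ω) φ) ∧
      Dense {φ : L2R | ParaproductConverges 1 0 (invSqrtCoeff ω) φ} ∧
      -- it extends to a bounded operator `T` on `L²(ℝ)` with norm at most `C [ω]_{A₂}`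
      (∃ T : L2R →L[ℝ] L2R, ‖T‖ ≤ C * (A2char ω).toReal ∧
        ∀ φ : L2R, ParaproductConverges 1 0 (invSqrtCoeff ω) φ →
          ParaproductConverges 0 1 (sqrtCoeff ω)
            (haarShift (paraproduct 1 0 (invSqrtCoeff ω) φ)) ∧
          T φ = paraproduct 0 1 (sqrtCoeff ω)
            (haarShift (paraproduct 1 0 (invSqrtCoeff ω) φ))) ∧
      -- the bound for multiplication by `ω^{1/2}` in place of the outer paraproduct
      (∀ φ : L2R, ParaproductConverges 1 0 (invSqrtCoeff ω) φ →
        eLpNorm (fun x => √(ω x) * haarShift (paraproduct 1 0 (invSqrtCoeff ω) φ) x) 2 volume ≤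
          ENNReal.ofReal (C * (A2char ω).toReal * ‖φ‖)) := by
  -- The constant of `sum_outer_sq_le`; it also dominates the 4800 of the multiplication bound.
  refine ⟨10000, by norm_num, fun ω hω hpos hA => ?_⟩
  have h := isA2Weight_of_A2char hω hpos hA
  set Q := (A2char ω).toReal
  have hQ := h.isA2Pair.one_le
  have hc : invSqrtCoeff ω = haarCoeff fun x => √(ω x)⁻¹ := by
    simp only [invSqrtCoeff, Real.sqrt_inv]
  have hspan := span_hL2_le_paraproductDomain (α := 1) (b := invSqrtCoeff ω)
  have hdense : Dense (paraproductDomain 1 0 (invSqrtCoeff ω) : Set L2R) :=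
    dense_span_hL2.mono hspan
  have hcoeff : ∀ φ : L2R, ParaproductConverges 1 0 (invSqrtCoeff ω) φ → ∀ J,
      inner ℝ (paraproduct 1 0 (invSqrtCoeff ω) φ) (hL2 0 J) = h.coeff φ J := by
    rw [hc]
    exact fun φ hφ J => inner_paraproduct h.inv.dyadicL2_sqrt hφ J
  have hmul : ∀ φ : L2R, ParaproductConverges 1 0 (invSqrtCoeff ω) φ →
      eLpNorm (fun x => √(ω x) * haarShift (paraproduct 1 0 (invSqrtCoeff ω) φ) x) 2 volume ≤
        ENNReal.ofReal (4800 * Q * ‖φ‖) := fun φ hφ => by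
    have := hasSum_haarShift (paraproduct 1 0 (invSqrtCoeff ω) φ)
    simp only [hcoeff φ hφ] at this
    exact h.eLpNorm_sqrt_mul_le this
  have hsq : ∀ φ : L2R, ParaproductConverges 1 0 (invSqrtCoeff ω) φ → ∀ s : Finset DyadicInterval,
      ∑ I ∈ s, (sqrtCoeff ω I *
        inner ℝ (haarShift (paraproduct 1 0 (invSqrtCoeff ω) φ)) (hL2 1 I)) ^ 2 ≤
        (10000 * Q * ‖φ‖) ^ 2 := fun φ hφ =>
    h.sum_outer_sq_le (fun J => (inner_haarShift_left _ J).trans (hcoeff φ hφ J))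
      (fun K hK => inner_haarShift_eq_zero _ hK) (hmul φ hφ)
  have hconv : ∀ φ : L2R, ParaproductConverges 1 0 (invSqrtCoeff ω) φ →
      ParaproductConverges 0 1 (sqrtCoeff ω) (haarShift (paraproduct 1 0 (invSqrtCoeff ω) φ)) :=
    fun φ hφ => by
      have := summable_smul_of_sum_sq_le orthonormal_hL2 (hsq φ hφ)
      exact this.congr fun I => (paraproductTerm_eq _ _ _ _ _).symm
  have hnorm : ∀ φ : L2R, ParaproductConverges 1 0 (invSqrtCoeff ω) φ →
      ‖paraproduct 0 1 (sqrtCoeff ω) (haarShift (paraproduct 1 0 (invSqrtCoeff ω) φ))‖ ≤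
        10000 * Q * ‖φ‖ := fun φ hφ => by
    have := norm_tsum_smul_sq_le (by positivity) (hsq φ hφ)
    rw [paraproduct]
    simp only [paraproductTerm_eq]
    exact this
  let A : paraproductDomain 1 0 (invSqrtCoeff ω) →ₗ[ℝ] L2R :=
    { toFun := fun φ =>
        paraproduct 0 1 (sqrtCoeff ω) (haarShift (paraproduct 1 0 (invSqrtCoeff ω) φ))
      map_add' := fun φ ψ => by
        rw [Submodule.coe_add, paraproduct_add φ.2 ψ.2, haarShift_add,
          paraproduct_add (hconv _ φ.2) (hconv _ ψ.2)]
      map_smul' := fun r φ => by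
        rw [Submodule.coe_smul, paraproduct_smul r φ.2, haarShift_smul,
          paraproduct_smul r (hconv _ φ.2), RingHom.id_apply] }
  obtain ⟨T, hT, hTA⟩ := exists_extension hdense A (by positivity : 0 ≤ 10000 * Q)
    fun φ => hnorm _ φ.2
  refine ⟨fun φ hφ => hspan hφ, hdense, ⟨T, hT, fun φ hφ => ⟨hconv φ hφ, hTA ⟨φ, hφ⟩⟩⟩,
    fun φ hφ => (hmul φ hφ).trans (ENNReal.ofReal_le_ofReal ?_)⟩
  gcongr
  norm_num
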